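/- A vector configuration $V$ is a finite family (repetitions allowed) of vectors in a real vector space; its rank $r$ is the dimension of its linear span $\mathrm{lin}(V)$, and $V$ is irreducible if it does not contain the zero vector. For a linear hyperplane $H$ (with a chosen orientation) let $H^+$ and $H^-$ be its open positive and negative sides and $\overline{H}^-=H\cup H^-$. The dual codegree is $\mathrm{codeg}^*(V)=\min_H|\overline{H}^-\cap V|$ (equal to $|V|$ if $r=0$), the dual degree is $\deg^*(V)=\max_H|H^+\cap V|-r$ (equal to $0$ if $r=0$), and the covector discrepancy is $\mathrm{Disc}(V)=\max_C\bigl||C^+|-|C^-|\bigr|$, where $C$ runs over the covectors $(\operatorname{sign} f(v))_{v\in V}$ of $V$, $f$ a linear functional. A codegree$^*$ decomposition of $V$ of length $m$ is a partition $V=V_0\uplus V_1\uplus\dots\uplus V_m$ with $\mathrm{codeg}^*(V_i)\ge 1$ for $1\le i\le m$ and $\mathrm{codeg}^*(V)=\sum_{i=1}^m\mathrm{codeg}^*(V_i)$ (the part $V_0$ may be empty). A configuration is centrally symmetric (up to rescaling) if its elements can be matched into antipodal pairs $\{w,-\lambda w\}$ with $\lambda>0$, zero vectors being allowed to stay unmatched;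 two configurations are skew if their linear spans meet only in $0$. Theorem. Let $V$ be an irreducible vector configuration of rank $r$ with $n=r+d+1$ elements, dual degree $\delta=\deg^*(V)$ and $\mathrm{Disc}(V)\le 2$. Then: (1) $V$ admits a codegree$^*$ decomposition of length at least $r-\mathrm{Disc}(V)$. (2) $r-\mathrm{Disc}(V)=d+1-2\delta$, so the length in (1) is at least $d+1-2\delta$. (3) $V$ is centrally symmetric except for one subconfiguration of rank at most $3$ or two skew subconfigurations of rank at most $2$: there is $W\subseteq V$ of rank at most $3$ with $V\setminus W$ centrally symmetric, or there are $W_1,W_2\subseteq V$, each of rank at most $2$, with $\mathrm{lin}(W_1)\cap\mathrm{lin}(W_2)=0$ and $V\setminus(W_1\cup W_2)$ centrally symmetric. -/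

import Mathlib

namespace VectorConfig

/-- The sign vectors `(sign f(v_i))_i` of a (finite, possibly repeating) vector configuration
`v : ι → E`, where `f` runs over the linear functionals. -/
def covectors {ι E : Type*} [AddCommGroup E] [Module ℝ E] (v : ι → E) : Set (ι → SignType) :=
  Set.range fun (f : Module.Dual ℝ E) (i : ι) => SignType.sign (f (v i))

/-- The discrepancy `||C⁺| - |C⁻||` of a sign vector. -/
def signDisc {ι : Type*} [Fintype ι] (C : ι → SignType) : ℕ :=
  (((Finset.univ.filter fun i => C i = 1).card : ℤ) -
    ((Finset.univ.filter fun i => C i = -1).card : ℤ)).natAbs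

/-- The covector discrepancy: the maximum of `||C⁺| - |C⁻||` over all covectors `C`. -/
noncomputable def disc {ι E : Type*} [Fintype ι] [AddCommGroup E] [Module ℝ E] (v : ι → E) : ℕ :=
  sSup (signDisc '' covectors v)

/-- The number of elements in the open positive side of the hyperplane `f = 0`. -/
noncomputable def posCount {ι E : Type*} [Fintype ι] [AddCommGroup E] [Module ℝ E]
    (v : ι → E) (f : Module.Dual ℝ E) : ℕ :=
  (Finset.univ.filter fun i => 0 < f (v i)).card

/-- The number of elements in the closed negative side of the hyperplane `f = 0`. -/
noncomputable def nonposCount {ι E : Type*} [Fintype ι] [AddCommGroup E] [Module ℝ E]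
    (v : ι → E) (f : Module.Dual ℝ E) : ℕ :=
  (Finset.univ.filter fun i => f (v i) ≤ 0).card

/-- The dual codegree: the minimal number of elements in a closed halfspace bounded by a linear
hyperplane. The functional `f = 0` is allowed: it counts all elements, so it never lowers the
minimum, and it gives the right value (the number of elements) in rank `0`. -/
noncomputable def codegStar {ι E : Type*} [Fintype ι] [AddCommGroup E] [Module ℝ E]
    (v : ι → E) : ℕ :=
  sInf (Set.range (nonposCount v))

/-- The rank: the dimension of the linear span. -/
noncomputable def rank {ι E : Type*} [AddCommGroup E] [Module ℝ E] (v : ι → E) : ℕ :=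
  Module.finrank ℝ (Submodule.span ℝ (Set.range v))

/-- The dual degree: the maximal number of elements in an open halfspace bounded by a linear
hyperplane, minus the rank. -/
noncomputable def degStar {ι E : Type*} [Fintype ι] [AddCommGroup E] [Module ℝ E]
    (v : ι → E) : ℤ :=
  ((sSup (Set.range (posCount v)) : ℕ) : ℤ) - (rank v : ℤ)

/-- The subconfiguration indexed by `s`. -/
def sub {ι E : Type*} (v : ι → E) (s : Finset ι) : s → E := fun i => v i

/-- A configuration is irreducible if it does not contain the zero vector. -/
def IsIrreducible {ι E : Type*} [AddCommGroup E] (v : ι → E) : Prop := ∀ i, v i ≠ 0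

/-- Centrally symmetric up to positive rescaling of the vectors: the elements are matched in
antipodal pairs `{w, -c w}`, `c > 0` (only a zero vector can be matched with itself). -/
def IsCentrallySymmetric {ι E : Type*} [AddCommGroup E] [Module ℝ E] (v : ι → E) : Prop :=
  ∃ σ : ι → ι, Function.Involutive σ ∧ ∀ i, ∃ c : ℝ, 0 < c ∧ v (σ i) = -(c • v i)

/-- Two configurations are skew if their linear spans intersect only in the origin. -/
def IsSkew {ι κ E : Type*} [AddCommGroup E] [Module ℝ E] (v : ι → E) (w : κ → E) : Prop :=
  Disjoint (Submodule.span ℝ (Set.range v)) (Submodule.span ℝ (Set.range w))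

/-- `v` admits a codegree* decomposition of length `m`: a partition into parts
`P 0, P 1, …, P m` where `P 1, …, P m` have positive dual codegree and their dual codegrees add
up to the dual codegree of `v` (no condition on `P 0`, which may be empty). -/
def HasCodegStarDecomposition {ι E : Type*} [Fintype ι] [AddCommGroup E] [Module ℝ E]
    (v : ι → E) (m : ℕ) : Prop :=
  ∃ P : Fin (m + 1) → Finset ι,
    (∀ i j, i ≠ j → Disjoint (P i) (P j)) ∧ (∀ a, ∃ i, a ∈ P i) ∧
    codegStar v = ∑ i : Fin m, codegStar (sub v (P i.succ)) ∧
    ∀ i : Fin m, 1 ≤ codegStar (sub v (P i.succ))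

/-- The maximum in the definition of `disc` is attained. -/
theorem isGreatest_disc {ι E : Type*} [Fintype ι] [AddCommGroup E] [Module ℝ E] (v : ι → E) :
    IsGreatest (signDisc '' covectors v) (disc v) := by
  classical
  have hfin : (signDisc '' covectors v).Finite := (Set.toFinite _).image _
  have hne : (signDisc '' covectors v).Nonempty := (Set.range_nonempty _).image _
  exact ⟨Nat.sSup_mem hne hfin.bddAbove, fun _ h => le_csSup hfin.bddAbove h⟩

/-- The minimum in the definition of `codegStar` is attained. -/
theorem isLeast_codegStar {ι E : Type*} [Fintype ι] [AddCommGroup E] [Module ℝ E] (v : ι → E) :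
    IsLeast (Set.range (nonposCount v)) (codegStar v) :=
  ⟨Nat.sInf_mem (Set.range_nonempty _), fun _ h => Nat.sInf_le h⟩

/-- The maximum in the definition of `degStar` is attained. -/
theorem isGreatest_posCount {ι E : Type*} [Fintype ι] [AddCommGroup E] [Module ℝ E] (v : ι → E) :
    IsGreatest (Set.range (posCount v)) (sSup (Set.range (posCount v))) := by
  have hb : BddAbove (Set.range (posCount v)) := by
    refine ⟨Fintype.card ι, ?_⟩
    rintro _ ⟨f, rfl⟩
    exact Finset.card_le_univ _
  exact ⟨Nat.sSup_mem (Set.range_nonempty _) hb, fun _ h => le_csSup hb h⟩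

end VectorConfig

/-! ### Signed counts, localization and contraction. -/

namespace VectorConfig

open Module Filter Topology

variable {ι E : Type*} [AddCommGroup E] [Module ℝ E]

/-! Deleting antipodal pairs changes no signed count, hence not the discrepancy, and each pair is a
part of dual codegree 1 that contributes at most 1 to the rank. Everything therefore hinges on the
reduced configuration `T` that is left. In the absence of zero vectors the extremal counts are
attained by generic functionals, so `2 * codegStar + disc` is the number of elements; (2) rewrites
this identity, and (1) follows from it once the rank of `T` is controlled.

The main tool is composition of covectors (`SignBound.flat_add`): the discrepancies of the
localization at a subspace and of the contraction by it add up to at most the discrepancy of the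
whole. In discrepancy 0, `T` is empty. In discrepancy 1 every nonempty flat of `T` has odd size, so
a plane spanned by two of its vectors contains a third, and Sylvester–Gallai puts `T` into a plane
(`Reduced.finrank_le_two`).

In discrepancy 2 the new case is `T` of even size. By the tool, an odd flat `U` has localization and
contraction of discrepancy at most 1. Hence odd flats have rank at most 2, and the even flats among
the `U ⊔ ℝ ∙ v j` lie in a space of rank at most `finrank U + 2`. Now speak projectively: rank 1 is
a point, rank 2 a line, rank 3 a plane. If the rank is at least 4, then inside any plane containing
an odd line each point of an odd line is on exactly one even line (`Planar`). The even lines through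
the points of an odd line are concurrent (`Planar.exists_center`). If every point were on an odd
line, adjoining the centre would contradict Sylvester–Gallai; so some point `a` is on no odd line,
and a second use of Sylvester–Gallai shows that `a` is the only point off the odd line. Consequently
all lines joining an odd line to outside points are even, which confines the outside points to two
different planes, hence to a line, skew to the first (`Tight.exists_skew`). -/

/-- The signed count `|C⁺| - |C⁻|` over `s` of the covector of the functional `f`. -/
noncomputable def signSum (v : ι → E) (s : Finset ι) (f : Dual ℝ E) : ℤ :=
  ∑ i ∈ s, (SignType.sign (f (v i)) : ℤ)

/-- All covectors of the subconfiguration `s` have discrepancy at most `k`. -/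
def SignBound (v : ι → E) (s : Finset ι) (k : ℤ) : Prop := ∀ f, |signSum v s f| ≤ k

open Classical in
/-- The elements of the subconfiguration `s` lying in the subspace `U`. -/
noncomputable def flat (v : ι → E) (s : Finset ι) (U : Submodule ℝ E) : Finset ι :=
  s.filter fun i => v i ∈ U

open Classical in
/-- The elements of the subconfiguration `s` lying outside the subspace `U`. -/
noncomputable def coflat (v : ι → E) (s : Finset ι) (U : Submodule ℝ E) : Finset ι :=
  s.filter fun i => v i ∉ U

@[simp] lemma mem_flat {v : ι → E} {s : Finset ι} {U : Submodule ℝ E} {i : ι} :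
    i ∈ flat v s U ↔ i ∈ s ∧ v i ∈ U := by simp [flat]

@[simp] lemma mem_coflat {v : ι → E} {s : Finset ι} {U : Submodule ℝ E} {i : ι} :
    i ∈ coflat v s U ↔ i ∈ s ∧ v i ∉ U := by simp [coflat]

/-- No zero vectors and no antipodal pairs. -/
structure Reduced (v : ι → E) (s : Finset ι) : Prop where
  ne_zero : ∀ i ∈ s, v i ≠ 0
  not_antipodal : ∀ i ∈ s, ∀ j ∈ s, ∀ c : ℝ, 0 < c → v j ≠ -(c • v i)

variable {v : ι → E} {s t : Finset ι} {U W : Submodule ℝ E} {f g : Dual ℝ E} {k : ℤ}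

lemma Reduced.mono (h : Reduced v s) (hts : t ⊆ s) : Reduced v t :=
  ⟨fun i hi => h.ne_zero i (hts hi), fun i hi j hj => h.not_antipodal i (hts hi) j (hts hj)⟩

lemma flat_subset : flat v s U ⊆ s := fun _ hi => (mem_flat.1 hi).1

lemma coflat_subset : coflat v s U ⊆ s := fun _ hi => (mem_coflat.1 hi).1

lemma flat_flat_of_le (h : U ≤ W) : flat v (flat v s W) U = flat v s U := by
  ext i
  simp only [mem_flat]
  exact ⟨fun hi => ⟨hi.1.1, hi.2⟩, fun hi => ⟨⟨hi.1, h hi.2⟩, hi.2⟩⟩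

lemma card_flat_add_card_coflat (v : ι → E) (s : Finset ι) (U : Submodule ℝ E) :
    (flat v s U).card + (coflat v s U).card = s.card := by
  classical
  unfold flat coflat
  exact Finset.card_filter_add_card_filter_not _

lemma signSum_flat_add_signSum_coflat (v : ι → E) (s : Finset ι) (U : Submodule ℝ E)
    (f : Dual ℝ E) : signSum v (flat v s U) f + signSum v (coflat v s U) f = signSum v s f := by
  classical
  unfold flat coflat signSum
  exact Finset.sum_filter_add_sum_filter_not _ _ _

lemma signSum_eq_zero (h : ∀ i ∈ s, f (v i) = 0) : signSum v s f = 0 :=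
  Finset.sum_eq_zero fun i hi => by simp [h i hi]

lemma signSum_coflat_of_le_ker (h : U ≤ LinearMap.ker f) :
    signSum v (coflat v s U) f = signSum v s f := by
  rw [← signSum_flat_add_signSum_coflat v s U f, signSum_eq_zero (s := flat v s U), zero_add]
  intro i hi
  exact h (mem_flat.1 hi).2

@[simp] lemma signSum_neg : signSum v s (-f) = -signSum v s f := by
  simp [signSum, Left.sign_neg, Finset.sum_neg_distrib]

lemma signSum_of_pos (h : ∀ i ∈ s, 0 < f (v i)) : signSum v s f = s.card := by
  unfold signSum
  rw [Finset.sum_congr rfl fun i hi => by rw [sign_pos (h i hi)]]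
  simp

lemma signSum_emod_two (h : ∀ i ∈ s, f (v i) ≠ 0) : signSum v s f % 2 = (s.card : ℤ) % 2 := by
  classical
  unfold signSum
  induction s using Finset.induction_on with
  | empty => simp
  | insert a s ha ih =>
    rw [Finset.sum_insert ha, Finset.card_insert_of_notMem ha]
    have h1 := ih fun i hi => h i (Finset.mem_insert_of_mem hi)
    rcases lt_or_gt_of_ne (h a (Finset.mem_insert_self _ _)) with h2 | h2
    · rw [sign_neg h2, SignType.coe_neg_one]; push_cast; omega
    · rw [sign_pos h2, SignType.coe_one]; push_cast; omega

/-- Perturbing `f` by a small multiple of `g` only changes the signs of the vectors in `ker f`. -/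
lemma exists_perturb (v : ι → E) (s : Finset ι) (f g : Dual ℝ E) :
    ∃ ε : ℝ, 0 < ε ∧ (∀ i ∈ s, f (v i) ≠ 0 →
        SignType.sign ((f + ε • g) (v i)) = SignType.sign (f (v i))) ∧
      ∀ i ∈ s, f (v i) = 0 → SignType.sign ((f + ε • g) (v i)) = SignType.sign (g (v i)) := by
  have key : ∀ i ∈ s, ∀ᶠ ε : ℝ in 𝓝[>] 0, f (v i) ≠ 0 →
      SignType.sign ((f + ε • g) (v i)) = SignType.sign (f (v i)) := by
    intro i _
    have ht : Tendsto (fun ε : ℝ => f (v i) + ε * g (v i)) (𝓝[>] 0) (𝓝 (f (v i))) := by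
      have : Continuous fun ε : ℝ => f (v i) + ε * g (v i) := by fun_prop
      simpa using (this.tendsto 0).mono_left nhdsWithin_le_nhds
    rcases lt_trichotomy (f (v i)) 0 with h | h | h
    · filter_upwards [ht.eventually (gt_mem_nhds h)] with ε hε _
      rw [sign_neg h, sign_neg (by simpa using hε)]
    · exact Eventually.of_forall fun ε h' => absurd h h'
    · filter_upwards [ht.eventually (lt_mem_nhds h)] with ε hε _
      rw [sign_pos h, sign_pos (by simpa using hε)]
  have h2 := ((eventually_all_finset s).2 key).and (self_mem_nhdsWithin (a := (0:ℝ)) (s := Set.Ioi 0))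
  obtain ⟨ε, h3, h4⟩ := h2.exists
  refine ⟨ε, h4, h3, fun i _ h => ?_⟩
  simp [h, sign_mul, sign_pos (show (0:ℝ) < ε from h4)]

lemma signSum_perturb (v : ι → E) (s : Finset ι) (f g : Dual ℝ E) :
    ∃ ε : ℝ, 0 < ε ∧ (∀ i ∈ s, f (v i) ≠ 0 →
        SignType.sign ((f + ε • g) (v i)) = SignType.sign (f (v i))) ∧
      (∀ i ∈ s, f (v i) = 0 → SignType.sign ((f + ε • g) (v i)) = SignType.sign (g (v i))) ∧
      signSum v s (f + ε • g) = signSum v s f + signSum v (flat v s (LinearMap.ker f)) g := by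
  obtain ⟨ε, hε, h1, h2⟩ := exists_perturb v s f g
  refine ⟨ε, hε, h1, h2, ?_⟩
  rw [← signSum_flat_add_signSum_coflat v s (LinearMap.ker f) (f + ε • g),
    ← signSum_coflat_of_le_ker (v := v) (s := s) (le_refl (LinearMap.ker f)), add_comm]
  congr 1
  · exact Finset.sum_congr rfl fun i hi => by
      rw [h1 i (mem_coflat.1 hi).1 fun h => (mem_coflat.1 hi).2 h]
  · exact Finset.sum_congr rfl fun i hi => by rw [h2 i (mem_flat.1 hi).1 (mem_flat.1 hi).2]

/-- A functional vanishing on `U` and at no vector of the configuration outside `U`. -/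
lemma exists_generic (v : ι → E) (s : Finset ι) (U : Submodule ℝ E) :
    ∃ f : Dual ℝ E, U ≤ LinearMap.ker f ∧ ∀ i ∈ s, v i ∉ U → f (v i) ≠ 0 := by
  obtain ⟨f, hf⟩ := Module.exists_dual_forall_apply_ne_zero (K := ℝ)
    (fun i : coflat v s U => U.mkQ (v i)) (fun i => by
      have := (mem_coflat.1 i.2).2
      simpa using this)
  refine ⟨f.comp U.mkQ, fun x hx => ?_, fun i hi hiU => ?_⟩
  · have : U.mkQ x = 0 := by simpa using hx
    simp [this]
  · exact hf ⟨i, mem_coflat.2 ⟨hi, hiU⟩⟩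

/-- A functional vanishing nowhere on `s` with at least the discrepancy of `f`. -/
lemma exists_generic_ge (h0 : ∀ i ∈ s, v i ≠ 0) (f : Dual ℝ E) :
    ∃ g : Dual ℝ E, (∀ i ∈ s, g (v i) ≠ 0) ∧ |signSum v s f| ≤ |signSum v s g| := by
  obtain ⟨g, -, hg⟩ := exists_generic v s (⊥ : Submodule ℝ E)
  have hg : ∀ i ∈ s, g (v i) ≠ 0 := fun i hi => hg i hi (by simpa using h0 i hi)
  have key : ∀ g : Dual ℝ E, (∀ i ∈ s, g (v i) ≠ 0) →
      ∃ g' : Dual ℝ E, (∀ i ∈ s, g' (v i) ≠ 0) ∧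
        signSum v s g' = signSum v s f + signSum v (flat v s (LinearMap.ker f)) g := by
    intro g hg
    obtain ⟨ε, hε, h1, h2, h3⟩ := signSum_perturb v s f g
    refine ⟨_, fun i hi => ?_, h3⟩
    rw [← sign_ne_zero]
    by_cases hf : f (v i) = 0
    · rw [h2 i hi hf]; exact sign_ne_zero.2 (hg i hi)
    · rw [h1 i hi hf]; exact sign_ne_zero.2 hf
  obtain ⟨g₁, h1, e1⟩ := key g hg
  -- The perturbations along `g` and `-g` shift the count by opposite amounts, so one of them does
  -- not lower its absolute value.
  obtain ⟨g₂, h2, e2⟩ := key (-g) fun i hi => by simpa using hg i hi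
  rw [signSum_neg] at e2
  rcases le_total |signSum v s f| |signSum v s g₁| with h | h
  · exact ⟨g₁, h1, h⟩
  · refine ⟨g₂, h2, ?_⟩
    rw [e2]
    rw [e1] at h
    grind

/-- The counts of the covector compositions of `f` with `g` and with `-g` are the sum and the
difference of the two numbers; one of these has the sum of the absolute values as its absolute
value. -/
lemma SignBound.perturb (h : SignBound v s k) (f g : Dual ℝ E) :
    |signSum v s f| + |signSum v (flat v s (LinearMap.ker f)) g| ≤ k := by
  obtain ⟨ε, -, -, -, h1⟩ := signSum_perturb v s f g
  obtain ⟨ε', -, -, -, h2⟩ := signSum_perturb v s f (-g)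
  have h3 := h (f + ε • g)
  have h4 := h (f + ε' • (-g))
  rw [h1] at h3
  rw [h2, signSum_neg] at h4
  grind

/-- Contraction by `U` (through `f`) and localization at `U` (through `g`) share the bound. Since
`ker f` may contain vectors outside `U`, `f` is first perturbed by `±f₀` generic modulo `U`; one of
the two signs does not lower the absolute value of the count. -/
lemma SignBound.flat_add (h : SignBound v s k)
    (hf : U ≤ LinearMap.ker f) (g : Dual ℝ E) :
    |signSum v s f| + |signSum v (flat v s U) g| ≤ k := by
  obtain ⟨f₀, hU, hf₀⟩ := exists_generic v s U
  have key : ∀ f₀ : Dual ℝ E, U ≤ LinearMap.ker f₀ → (∀ i ∈ s, v i ∉ U → f₀ (v i) ≠ 0) →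
      |signSum v s f + signSum v (flat v s (LinearMap.ker f)) f₀| +
        |signSum v (flat v s U) g| ≤ k := by
    intro f₀ hU hf₀
    obtain ⟨ε, hε, h1, h2, h3⟩ := signSum_perturb v s f f₀
    have := h.perturb (f + ε • f₀) g
    rw [h3] at this
    convert this using 4
    ext i
    simp only [mem_flat, LinearMap.mem_ker, and_congr_right_iff]
    intro hi
    constructor
    · intro hiU
      have a1 : f (v i) = 0 := hf hiU
      have a2 : f₀ (v i) = 0 := hU hiU
      simp [a1, a2]
    · intro h0
      by_contra hiU
      have := sign_eq_zero_iff.2 h0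
      by_cases h5 : f (v i) = 0
      · rw [h2 i hi h5] at this
        exact hf₀ i hi hiU (sign_eq_zero_iff.1 this)
      · rw [h1 i hi h5] at this
        exact h5 (sign_eq_zero_iff.1 this)
  have h1 := key f₀ hU hf₀
  have h2 := key (-f₀) (fun x hx => by simpa using hU hx) fun i hi hiU => by
    simpa using hf₀ i hi hiU
  rw [signSum_neg] at h2
  grind

lemma SignBound.flat (h : SignBound v s k) (U : Submodule ℝ E) :
    SignBound v (flat v s U) k := fun g => by
  have := h.flat_add (f := 0) (U := U) (by simp) g
  have := abs_nonneg (signSum v s 0)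
  omega

/-- In a reduced configuration parallel vectors are positive multiples of each other. -/
lemma Reduced.pos_of_mem_span (h : Reduced v s) {i j : ι} (hi : i ∈ s) (hj : j ∈ s)
    (hij : v j ∈ ℝ ∙ v i) (hf : 0 < f (v i)) : 0 < f (v j) := by
  obtain ⟨c, hc⟩ := Submodule.mem_span_singleton.1 hij
  rcases lt_trichotomy c 0 with h0 | h0 | h0
  · refine absurd ?_ (h.not_antipodal i hi j hj (-c) (by linarith))
    simp [hc]
  · refine absurd ?_ (h.ne_zero j hj)
    simp [← hc, h0]
  · rw [← hc]
    simpa using mul_pos h0 hf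

lemma exists_dual_pos {x : E} (hx : x ≠ 0) :
    ∃ f : Dual ℝ E, 0 < f x := by
  obtain ⟨f, hf⟩ := Module.exists_dual_forall_apply_ne_zero (K := ℝ) (fun _ : Unit => x)
    (fun _ => hx)
  rcases lt_or_gt_of_ne (hf ()) with h | h
  · exact ⟨-f, by simpa using h⟩
  · exact ⟨f, h⟩

/-- Localize at one direction: its vectors are all positive multiples of each other, so nothing
cancels there, whereas bound 0 would pass to the localization. -/
lemma Reduced.exists_signSum_ne_zero (h : Reduced v s)
    (hs : s.Nonempty) : ∃ g : Dual ℝ E, (∀ i ∈ s, g (v i) ≠ 0) ∧ signSum v s g ≠ 0 := by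
  obtain ⟨i, hi⟩ := hs
  suffices ∃ f, signSum v s f ≠ 0 by
    obtain ⟨f, hf⟩ := this
    obtain ⟨g, hg, hfg⟩ := exists_generic_ge h.ne_zero f
    refine ⟨g, hg, fun h0 => hf ?_⟩
    rw [h0] at hfg
    simpa using hfg
  by_contra! hcon
  have hB : SignBound v s 0 := fun f => by simp [hcon f]
  obtain ⟨g, hg⟩ := exists_dual_pos (h.ne_zero i hi)
  have h1 := hB.flat (ℝ ∙ v i) g
  rw [signSum_of_pos fun j hj =>
    h.pos_of_mem_span hi (mem_flat.1 hj).1 (mem_flat.1 hj).2 hg] at h1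
  have : 0 < (VectorConfig.flat v s (ℝ ∙ v i)).card :=
    Finset.card_pos.2 ⟨i, mem_flat.2 ⟨hi, Submodule.mem_span_singleton_self _⟩⟩
  simp at h1
  simp [h1] at this

/-! ### Removing antipodal pairs. -/

/-- Sets of indices that split into antipodal pairs. -/
inductive AntipodalPairs [DecidableEq ι] (v : ι → E) : Finset ι → Prop
  | empty : AntipodalPairs v ∅
  | cons (i j : ι) (s : Finset ι) (hi : i ∉ s) (hj : j ∉ s) (hij : i ≠ j) (c : ℝ) (hc : 0 < c)
      (h : v j = -(c • v i)) (hs : AntipodalPairs v s) : AntipodalPairs v (insert i (insert j s))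

lemma exists_reduced [DecidableEq ι] (v : ι → E) (s : Finset ι) (h0 : ∀ i ∈ s, v i ≠ 0) :
    ∃ t ⊆ s, Reduced v t ∧ AntipodalPairs v (s \ t) := by
  induction s using Finset.strongInduction with
  | H s ih =>
    by_cases hs : Reduced v s
    · exact ⟨s, subset_rfl, hs, by simpa using AntipodalPairs.empty⟩
    · have : ∃ i ∈ s, ∃ j ∈ s, ∃ c : ℝ, 0 < c ∧ v j = -(c • v i) := by
        by_contra! hcon
        exact hs ⟨h0, hcon⟩
      obtain ⟨i, hi, j, hj, c, hc, hij⟩ := this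
      have hne : i ≠ j := by
        rintro rfl
        have h1 : (1 + c) • v i = 0 := by
          rw [add_smul, one_smul]; nth_rewrite 1 [hij]; simp
        rcases smul_eq_zero.1 h1 with h | h
        · linarith
        · exact h0 i hi h
      obtain ⟨t, hts, ht, hp⟩ := ih ((s.erase i).erase j)
        (((Finset.erase_subset _ _).trans_ssubset (Finset.erase_ssubset hi)))
        (fun k hk => h0 k (Finset.mem_of_mem_erase (Finset.mem_of_mem_erase hk)))
      have hit : i ∉ t := fun h => by simpa using hts h
      have hjt : j ∉ t := fun h => by simpa using hts h
      refine ⟨t, hts.trans ((Finset.erase_subset _ _).trans (Finset.erase_subset _ _)), ht, ?_⟩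
      have := AntipodalPairs.cons i j _ (by simp) (by simp) hne c hc hij hp
      convert this using 1
      ext k
      simp only [Finset.mem_sdiff, Finset.mem_insert, Finset.mem_erase]
      by_cases h1 : k = i
      · subst h1; simp [hi, hit]
      · by_cases h2 : k = j
        · subst h2; simp [hj, hjt]
        · simp [h1, h2]

lemma AntipodalPairs.signSum_eq_zero [DecidableEq ι] (h : AntipodalPairs v s) (f : Dual ℝ E) :
    signSum v s f = 0 := by
  induction h with
  | empty => simp [signSum]
  | cons i j s hi hj hij c hc h hs ih =>
    unfold signSum at *
    rw [Finset.sum_insert (by simp [hi, hij]), Finset.sum_insert hj, ih, h]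
    simp [Left.sign_neg, sign_mul, sign_pos hc]

lemma AntipodalPairs.even_card_flat [DecidableEq ι] (h : AntipodalPairs v s)
    (U : Submodule ℝ E) : Even (flat v s U).card := by
  classical
  induction h with
  | empty => simp [flat]
  | cons i j s hi hj hij c hc h hs ih =>
    have hiff : v j ∈ U ↔ v i ∈ U := by
      rw [h, U.neg_mem_iff]
      exact U.smul_mem_iff hc.ne'
    unfold flat at *
    by_cases hU : v i ∈ U
    · rw [Finset.filter_insert, if_pos hU, Finset.filter_insert, if_pos (hiff.2 hU),
        Finset.card_insert_of_notMem (by simp [hi, hij]), Finset.card_insert_of_notMem (by simp [hj])]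
      exact ih.add (even_two)
    · rw [Finset.filter_insert, if_neg hU, Finset.filter_insert, if_neg (fun h => hU (hiff.1 h))]
      exact ih

lemma signSum_sdiff_add [DecidableEq ι] (hts : t ⊆ s) (f : Dual ℝ E) :
    signSum v (s \ t) f + signSum v t f = signSum v s f := Finset.sum_sdiff hts

lemma card_flat_sdiff_add [DecidableEq ι] (hts : t ⊆ s) (U : Submodule ℝ E) :
    (flat v (s \ t) U).card + (flat v t U).card = (flat v s U).card := by
  classical
  rw [← Finset.card_sdiff_add_card_eq_card (s := flat v t U) (t := flat v s U)]
  · congr 2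
    ext i; simp [flat]; tauto
  · intro i hi
    simp only [mem_flat] at *
    exact ⟨hts hi.1, hi.2⟩

end VectorConfig

/-! ### The Sylvester–Gallai theorem. -/

namespace VectorConfig

open Module Submodule

section SylvesterGallai

variable {V : Type*} [NormedAddCommGroup V] [InnerProductSpace ℝ V]

/-- The Gram determinant of two vectors. -/
noncomputable def gram (x y : V) : ℝ := inner ℝ x x * inner ℝ y y - inner ℝ x y ^ 2

lemma gram_nonneg (x y : V) : 0 ≤ gram x y := by
  have := real_inner_mul_inner_self_le x y
  unfold gram; nlinarith

/-- Two of three reals lie weakly on the same side of 0; take `i` to be the one nearer to 0 and `j`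
the farther one. -/
lemma exists_sq_sub_le (x : Fin 3 → ℝ) : ∃ i j, i ≠ j ∧ (x j - x i) ^ 2 ≤ x j ^ 2 := by
  have key : ∀ i j, i ≠ j → 0 ≤ x i * x j → ∃ i j, i ≠ j ∧ (x j - x i) ^ 2 ≤ x j ^ 2 := by
    intro i j hij h
    rcases le_total (x i ^ 2) (x j ^ 2) with h1 | h1
    · refine ⟨i, j, hij, ?_⟩
      have : x i ^ 2 ≤ x i * x j := by
        have h2 := sq_le_sq.1 h1
        calc x i ^ 2 = |x i| * |x i| := by rw [← abs_mul, ← sq, abs_of_nonneg (sq_nonneg _)]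
          _ ≤ |x i| * |x j| := by gcongr
          _ = x i * x j := by rw [← abs_mul, abs_of_nonneg h]
      nlinarith
    · refine ⟨j, i, hij.symm, ?_⟩
      have : x j ^ 2 ≤ x i * x j := by
        have h2 := sq_le_sq.1 h1
        calc x j ^ 2 = |x j| * |x j| := by rw [← abs_mul, ← sq, abs_of_nonneg (sq_nonneg _)]
          _ ≤ |x i| * |x j| := by gcongr
          _ = x i * x j := by rw [← abs_mul, abs_of_nonneg h]
      nlinarith
  by_contra! hcon
  have h1 : ∀ i j, i ≠ j → x i * x j < 0 := fun i j hij => by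
    by_contra! h
    obtain ⟨i, j, h2, h3⟩ := key i j hij h
    exact absurd h3 (not_le.2 (hcon i j h2))
  have a := h1 0 1 (by decide)
  have b := h1 1 2 (by decide)
  have c := h1 0 2 (by decide)
  have := mul_pos_of_neg_of_neg a b
  nlinarith [mul_nonneg (sq_nonneg (x 1)) (neg_nonneg.2 c.le)]

/-- The Sylvester–Gallai theorem for points in a Euclidean space. -/
theorem gram_eq_zero_of_no_ordinary_line {A : Set V} (hA : A.Finite)
    (h : ∀ x ∈ A, ∀ y ∈ A, x ≠ y → ∃ t : ℝ, t ≠ 0 ∧ t ≠ 1 ∧ x + t • (y - x) ∈ A) :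
    ∀ x ∈ A, ∀ y ∈ A, ∀ z ∈ A, gram (x - y) (z - y) = 0 := by
  by_contra! hcon
  obtain ⟨x, hx, y, hy, z, hz, hne⟩ := hcon
  let T : Set (V × V × V) := {p | p ∈ A ×ˢ (A ×ˢ A) ∧ gram (p.1 - p.2.1) (p.2.2 - p.2.1) ≠ 0}
  have hT : T.Finite := (hA.prod (hA.prod hA)).subset fun p hp => hp.1
  -- Kelly's argument: the quotient is the squared distance from the first point to the line through
  -- the other two, and a noncollinear triple minimizing it is chosen.
  obtain ⟨⟨P, Q, R⟩, ⟨⟨hP, hQ, hR⟩, hne⟩, hmin⟩ := Set.exists_min_image T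
    (fun p => gram (p.1 - p.2.1) (p.2.2 - p.2.1) / inner ℝ (p.2.2 - p.2.1) (p.2.2 - p.2.1)) hT
    ⟨(x, y, z), ⟨hx, hy, hz⟩, hne⟩
  simp only at hP hQ hR hne hmin
  have hQR : Q ≠ R := by
    rintro rfl
    simp [gram] at hne
  obtain ⟨t, ht0, ht1, htA⟩ := h Q hQ R hR hQR
  set q := P - Q with hq
  set w := R - Q with hw
  have hPq : P = Q + q := by simp [hq]
  have hRw : R = Q + w := by simp [hw]
  have hn : 0 < inner ℝ w w := real_inner_self_pos.2 (sub_ne_zero.2 hQR.symm)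
  have hG : 0 < gram q w := lt_of_le_of_ne (gram_nonneg _ _) hne.symm
  let τ : Fin 3 → ℝ := ![0, 1, t]
  have hτA : ∀ i, Q + τ i • w ∈ A := by
    intro i
    fin_cases i
    · simpa [τ] using hQ
    · simpa [τ, ← hRw] using hR
    · exact htA
  have hτ : ∀ i j, i ≠ j → τ i ≠ τ j := by
    intro i j hij
    fin_cases i <;> fin_cases j <;> simp [τ] at hij ⊢ <;>
      first | exact ht0 | exact ht1 | exact ht0.symm | exact ht1.symm
  -- Up to the factor `inner ℝ w w`, these are the positions on the line `QR` relative to the foot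
  -- of the perpendicular from `P`.
  obtain ⟨i, j, hij, hsq⟩ := exists_sq_sub_le fun i => τ i * inner ℝ w w - inner ℝ q w
  generalize hb : τ i = b at *
  generalize hc : τ j = c at *
  have hbc : b ≠ c := by rw [← hb, ← hc]; exact hτ i j hij
  have hBA : Q + b • w ∈ A := hb ▸ hτA i
  have hCA : Q + c • w ∈ A := hc ▸ hτA j
  have e1 : (Q + b • w) - P = b • w - q := by rw [hPq]; abel
  have e2 : (Q + c • w) - P = c • w - q := by rw [hPq]; abel
  have hgram : gram (b • w - q) (c • w - q) = (c - b) ^ 2 * gram q w := by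
    simp only [gram, inner_sub_left, inner_sub_right, inner_smul_left, inner_smul_right,
      real_inner_comm w q]
    simp
    ring
  have hCn : inner ℝ (c • w - q) (c • w - q) * inner ℝ w w =
      gram q w + (c * inner ℝ w w - inner ℝ q w) ^ 2 := by
    simp only [gram, inner_sub_left, inner_sub_right, inner_smul_left, inner_smul_right,
      real_inner_comm w q]
    simp
    ring
  have hlt : (c - b) ^ 2 * (inner ℝ w w * inner ℝ w w) <
      inner ℝ (c • w - q) (c • w - q) * inner ℝ w w := by
    rw [hCn]; nlinarith
  have hcb : 0 < (c - b) ^ 2 := by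
    have := sub_ne_zero.2 hbc.symm
    positivity
  have hCpos : 0 < inner ℝ (c • w - q) (c • w - q) := by
    by_contra! hle
    nlinarith [mul_pos hcb (mul_pos hn hn)]
  -- The nearer point `Q + b • w` is closer to the line joining `P` to the farther one than `P` is
  -- to `QR`, against minimality.
  have hm := hmin (Q + b • w, P, Q + c • w) ⟨⟨hBA, hP, hCA⟩, by
    simp only [e1, e2, hgram]
    exact (mul_pos hcb hG).ne'⟩
  simp only [e1, e2, hgram] at hm
  rw [div_le_div_iff₀ hn hCpos] at hm
  have : (c - b) ^ 2 * inner ℝ w w < inner ℝ (c • w - q) (c • w - q) := by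
    by_contra! hle
    nlinarith
  nlinarith

end SylvesterGallai

variable {E : Type*} [AddCommGroup E] [Module ℝ E]

/-- The Sylvester–Gallai theorem for vectors: if every plane spanned by two vectors of a finite
family contains a third one, up to scaling, then the family lies in a plane. -/
theorem mem_span_pair_of_no_ordinary_plane [FiniteDimensional ℝ E]
    {A : Set E} (hA : A.Finite) (h0 : ∀ x ∈ A, x ≠ 0)
    (h : ∀ x ∈ A, ∀ y ∈ A, y ∉ ℝ ∙ x → ∃ z ∈ A, z ∈ span ℝ {x, y} ∧ z ∉ ℝ ∙ x ∧ z ∉ ℝ ∙ y)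
    {x y z : E} (hx : x ∈ A) (hy : y ∈ A) (hz : z ∈ A) (hxy : y ∉ ℝ ∙ x) :
    z ∈ span ℝ {x, y} := by
  obtain ⟨f, hf⟩ := Module.exists_dual_forall_apply_ne_zero (K := ℝ) (ι := hA.toFinset)
    (fun a => (a : E)) (fun a => h0 a (hA.mem_toFinset.1 a.2))
  have hf : ∀ a ∈ A, f a ≠ 0 := fun a ha => hf ⟨a, by simpa using ha⟩
  have : ∃ e : E ≃ₗ[ℝ] EuclideanSpace ℝ (Fin (finrank ℝ E)), True :=
    ⟨(finBasis ℝ E).equivFun.trans (WithLp.linearEquiv 2 ℝ _).symm, trivial⟩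
  obtain ⟨e, -⟩ := this
  -- Rescaling into the affine hyperplane `f = 1` turns directions into points and planes through
  -- the origin into affine lines.
  let N : E → E := fun a => (f a)⁻¹ • a
  have hN : ∀ a, N a = (f a)⁻¹ • a := fun _ => rfl
  have hNmem : ∀ a ∈ A, a ∈ ℝ ∙ N a := fun a ha => mem_span_singleton.2
    ⟨f a, by rw [hN, smul_smul, mul_inv_cancel₀ (hf a ha), one_smul]⟩
  have hNf : ∀ a ∈ A, f (N a) = 1 := fun a ha => by simp [hN, hf a ha]
  have key := gram_eq_zero_of_no_ordinary_line (A := (fun a => e (N a)) '' A) (hA.image _) (by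
    rintro _ ⟨a, ha, rfl⟩ _ ⟨b, hb, rfl⟩ hne
    have hab : b ∉ ℝ ∙ a := by
      intro hba
      obtain ⟨c, rfl⟩ := mem_span_singleton.1 hba
      apply hne
      have hc : c ≠ 0 := by rintro rfl; exact h0 _ hb (by simp)
      simp only [hN, map_smul, smul_smul, smul_eq_mul]
      congr 1
      field_simp
    obtain ⟨z, hz, hzab, hza, hzb⟩ := h a ha b hb hab
    obtain ⟨p, q, hpq⟩ := mem_span_pair.1 hzab
    have hz1 := hNf z hz
    have hp : p ≠ 0 := by rintro rfl; exact hzb (mem_span_singleton.2 ⟨q, by simpa using hpq⟩)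
    have hq : q ≠ 0 := by rintro rfl; exact hza (mem_span_singleton.2 ⟨p, by simpa using hpq⟩)
    have hfz : f z = p * f a + q * f b := by simp [← hpq]
    have hfz0 := hf z hz
    have hfa := hf a ha
    have hfb := hf b hb
    refine ⟨q * f b / f z, by positivity, ?_, z, hz, ?_⟩
    · rw [Ne, div_eq_one_iff_eq hfz0, hfz]
      intro h
      have : p * f a = 0 := by linarith
      exact (mul_ne_zero hp hfa) this
    · simp only [← map_sub, ← map_smul, ← map_add]
      congr 1
      simp only [hN, ← hpq, smul_add, smul_sub, smul_smul]
      rw [hpq]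
      have e1 : (f z)⁻¹ * p = (f a)⁻¹ - q * f b / f z * (f a)⁻¹ := by
        field_simp
        linarith
      have e2 : (f z)⁻¹ * q = q * f b / f z * (f b)⁻¹ := by field_simp
      rw [e1, e2, sub_smul]
      abel)
  have hg := key _ ⟨z, hz, rfl⟩ _ ⟨x, hx, rfl⟩ _ ⟨y, hy, rfl⟩
  simp only [← map_sub] at hg
  have hne : e (N y - N x) ≠ 0 := by
    intro h1
    rw [e.map_eq_zero_iff, sub_eq_zero] at h1
    have := hNmem y hy
    rw [h1] at this
    exact hxy ((span_singleton_le_iff_mem _ _).2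
      (smul_mem _ _ (mem_span_singleton_self x)) this)
  have hn : 0 < inner ℝ (e (N y - N x)) (e (N y - N x)) := real_inner_self_pos.2 hne
  set τ : ℝ := inner ℝ (e (N z - N x)) (e (N y - N x)) /
    inner ℝ (e (N y - N x)) (e (N y - N x)) with hτ
  have h2 : e (N z - N x) - τ • e (N y - N x) = 0 := by
    rw [← inner_self_eq_zero (𝕜 := ℝ)]
    simp only [gram] at hg
    simp only [inner_sub_left, inner_sub_right, inner_smul_left, inner_smul_right,
      real_inner_comm (e (N z - N x)) (e (N y - N x)), RCLike.conj_to_real] at *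
    rw [hτ]
    field_simp
    linarith
  rw [← map_smul, ← map_sub, e.map_eq_zero_iff] at h2
  have h3 : N z = N x + τ • (N y - N x) := by
    rw [sub_eq_zero] at h2
    rw [← h2]; abel
  have hNx : N x ∈ span ℝ {x, y} := smul_mem _ _ (subset_span (by simp))
  have hNy : N y ∈ span ℝ {x, y} := smul_mem _ _ (subset_span (by simp))
  have h4 : N z ∈ span ℝ {x, y} := by
    rw [h3]
    exact add_mem hNx (smul_mem _ _ (sub_mem hNy hNx))
  exact (span_singleton_le_iff_mem _ _).2 h4 (hNmem z hz)

end VectorConfig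

/-! ### Discrepancy one, and odd flats in discrepancy two. -/

namespace VectorConfig

open Module Submodule

variable {ι E : Type*} [AddCommGroup E] [Module ℝ E]
  {v : ι → E} {s t : Finset ι} {U W : Submodule ℝ E} {f g : Dual ℝ E} {k : ℤ}

lemma exists_mem_of_odd_of_two {s : Finset ι} {i j : ι} (h : Odd s.card) (hi : i ∈ s) (hj : j ∈ s)
    (hij : i ≠ j) : ∃ k ∈ s, k ≠ i ∧ k ≠ j := by
  classical
  have hsub : ({i, j} : Finset ι) ⊆ s := by
    intro x; simp only [Finset.mem_insert, Finset.mem_singleton]; rintro (rfl | rfl) <;> assumption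
  have h2 : ({i, j} : Finset ι).card = 2 := Finset.card_pair hij
  have h3 := Finset.card_le_card hsub
  have h4 : ({i, j} : Finset ι).card < s.card := by
    rcases h with ⟨m, hm⟩; omega
  obtain ⟨k, hk, hk'⟩ := Finset.exists_mem_notMem_of_card_lt_card h4
  exact ⟨k, hk, by simp at hk'; tauto⟩

lemma finrank_span_image_le_two [FiniteDimensional ℝ E] (h0 : ∀ i ∈ s, v i ≠ 0)
    (h : ∀ i ∈ s, ∀ j ∈ s, ∀ k ∈ s, v j ∉ ℝ ∙ v i → v k ∈ span ℝ {v i, v j}) :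
    finrank ℝ (span ℝ (v '' s)) ≤ 2 := by
  classical
  have pair : ∀ x y : E, finrank ℝ (span ℝ ({x, y} : Set E)) ≤ 2 := fun x y => by
    have := finrank_span_finset_le_card (R := ℝ) ({x, y} : Finset E)
    rw [Finset.coe_pair, Set.finrank] at this
    exact this.trans Finset.card_le_two
  by_cases hs : ∃ i ∈ s, ∃ j ∈ s, v j ∉ ℝ ∙ v i
  · obtain ⟨i, hi, j, hj, hij⟩ := hs
    refine (finrank_mono (span_le.2 ?_)).trans (pair (v i) (v j))
    rintro _ ⟨k, hk, rfl⟩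
    exact h i hi j hj k hk hij
  · push Not at hs
    rcases s.eq_empty_or_nonempty with rfl | ⟨i, hi⟩
    · rw [Finset.coe_empty, Set.image_empty, span_empty, finrank_bot]
      exact Nat.zero_le _
    · refine (finrank_mono (span_le.2 ?_)).trans (pair (v i) (v i))
      rintro _ ⟨k, hk, rfl⟩
      simpa using hs i hi k hk

/-- A generic count that is nonzero must be `±1`, and generic counts have the parity of the size. -/
lemma Reduced.odd_card (h : Reduced v s) (hB : SignBound v s 1) (hs : s.Nonempty) :
    Odd s.card := by
  obtain ⟨g, hg, hne⟩ := h.exists_signSum_ne_zero hs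
  have h1 := hB g
  have h2 := signSum_emod_two hg
  have h3 := abs_pos.2 hne
  rw [← Nat.not_even_iff_odd]
  rintro ⟨m, hm⟩
  rw [hm] at h2
  grind

lemma Reduced.odd_card_flat (h : Reduced v s) (hB : SignBound v s 1) (U : Submodule ℝ E)
    (hs : (flat v s U).Nonempty) : Odd (flat v s U).card :=
  (h.mono flat_subset).odd_card (hB.flat U) hs

lemma Reduced.card_flat_singleton_le {k : ℕ} (h : Reduced v s) (hB : SignBound v s k) {i : ι}
    (hi : i ∈ s) : (flat v s (ℝ ∙ v i)).card ≤ k := by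
  obtain ⟨f, hf⟩ := exists_dual_pos (h.ne_zero i hi)
  have := hB.flat (ℝ ∙ v i) f
  rw [signSum_of_pos fun j hj =>
    h.pos_of_mem_span hi (mem_flat.1 hj).1 (mem_flat.1 hj).2 hf] at this
  simpa using this

lemma Reduced.eq_of_mem_span (h : Reduced v s) (hB : SignBound v s 1) {i j : ι}
    (hi : i ∈ s) (hj : j ∈ s) (hij : v j ∈ ℝ ∙ v i) : i = j :=
  Finset.card_le_one.1 (h.card_flat_singleton_le (k := 1) hB hi) _
    (mem_flat.2 ⟨hi, mem_span_singleton_self _⟩) _ (mem_flat.2 ⟨hj, hij⟩)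

/-- A reduced configuration of discrepancy at most one lies in a plane. -/
lemma Reduced.mem_span_pair [FiniteDimensional ℝ E]
    (h : Reduced v s) (hB : SignBound v s 1) {i j k : ι}
    (hi : i ∈ s) (hj : j ∈ s) (hk : k ∈ s) (hij : v j ∉ ℝ ∙ v i) : v k ∈ span ℝ {v i, v j} := by
  refine mem_span_pair_of_no_ordinary_plane (A := v '' s) (s.finite_toSet.image v) ?_ ?_
    ⟨i, hi, rfl⟩ ⟨j, hj, rfl⟩ ⟨k, hk, rfl⟩ hij
  · rintro _ ⟨i, hi, rfl⟩; exact h.ne_zero i hi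
  · rintro _ ⟨i, hi, rfl⟩ _ ⟨j, hj, rfl⟩ hij
    have hi' : i ∈ flat v s (span ℝ {v i, v j}) := mem_flat.2 ⟨hi, subset_span (by simp)⟩
    have hj' : j ∈ flat v s (span ℝ {v i, v j}) := mem_flat.2 ⟨hj, subset_span (by simp)⟩
    have hne : i ≠ j := by rintro rfl; exact hij (mem_span_singleton_self _)
    obtain ⟨k, hk, hki, hkj⟩ := exists_mem_of_odd_of_two
      (h.odd_card_flat hB _ ⟨i, hi'⟩) hi' hj' hne
    rw [mem_flat] at hk
    exact ⟨v k, ⟨k, hk.1, rfl⟩, hk.2, fun h1 => hki (h.eq_of_mem_span hB hi hk.1 h1).symm,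
      fun h1 => hkj (h.eq_of_mem_span hB hj hk.1 h1).symm⟩

lemma Reduced.finrank_le_two [FiniteDimensional ℝ E] (h : Reduced v s) (hB : SignBound v s 1) :
    finrank ℝ (span ℝ (v '' s)) ≤ 2 :=
  finrank_span_image_le_two h.ne_zero fun _ hi _ hj _ hk hij => h.mem_span_pair hB hi hj hk hij

/-- The standing assumption in the case of discrepancy two. -/
structure Tight (v : ι → E) (s : Finset ι) : Prop where
  reduced : Reduced v s
  bound : SignBound v s 2
  even : Even s.card

lemma Tight.flat (h : Tight v s) (hU : Even (flat v s U).card) : Tight v (flat v s U) :=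
  ⟨h.reduced.mono flat_subset, h.bound.flat U, hU⟩

lemma Tight.odd_coflat (h : Tight v s) (hU : Odd (VectorConfig.flat v s U).card) :
    Odd (coflat v s U).card := by
  have := card_flat_add_card_coflat v s U
  have h2 := h.even
  rw [← this] at h2
  grind

/-- A generic count on an odd flat is nonzero, so the localization uses up at least 1 of the bound 2
and leaves at most 1 for the contraction. -/
lemma Tight.abs_le_one (h : Tight v s) (hU : Odd (VectorConfig.flat v s U).card)
    (hf : U ≤ LinearMap.ker f) : |signSum v s f| ≤ 1 := by
  obtain ⟨g, -, hg⟩ := exists_generic v (VectorConfig.flat v s U) (⊥ : Submodule ℝ E)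
  have hg : ∀ i ∈ VectorConfig.flat v s U, g (v i) ≠ 0 := fun i hi =>
    hg i hi (by simpa using h.reduced.ne_zero i (flat_subset hi))
  have h1 := h.bound.flat_add hf g
  have h2 := signSum_emod_two hg
  obtain ⟨m, hm⟩ := hU
  have h3 : signSum v (VectorConfig.flat v s U) g ≠ 0 := by
    intro h; rw [h, hm] at h2; push_cast at h2; omega
  have := abs_pos.2 h3
  omega

/-- Dual to `Tight.abs_le_one`: the complement of `U` is odd as well, so the contraction uses up at
least 1. -/
lemma Tight.signBound_one (h : Tight v s) (hU : Odd (VectorConfig.flat v s U).card) :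
    SignBound v (VectorConfig.flat v s U) 1 := by
  obtain ⟨f, hf, hfne⟩ := exists_generic v s U
  intro g
  have h1 := h.bound.flat_add hf g
  have h2 : signSum v (coflat v s U) f % 2 = _ := signSum_emod_two fun i hi =>
    hfne i (mem_coflat.1 hi).1 (mem_coflat.1 hi).2
  rw [signSum_coflat_of_le_ker hf] at h2
  obtain ⟨m, hm⟩ := h.odd_coflat hU
  have h3 : signSum v s f ≠ 0 := by
    intro h; rw [h, hm] at h2; push_cast at h2; omega
  have := abs_pos.2 h3
  omega

lemma Tight.eq_of_odd (h : Tight v s) (hU : Odd (VectorConfig.flat v s U).card) {i j : ι}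
    (hi : i ∈ s) (hiU : v i ∈ U) (hj : j ∈ s) (hij : v j ∈ ℝ ∙ v i) : i = j :=
  (h.reduced.mono flat_subset).eq_of_mem_span (h.signBound_one hU) (mem_flat.2 ⟨hi, hiU⟩)
    (mem_flat.2 ⟨hj, (span_singleton_le_iff_mem _ _).2 hiU hij⟩) hij

lemma Tight.even_of_indep [FiniteDimensional ℝ E]
    (h : Tight v s) {i j k : ι} (hi : i ∈ s) (hj : j ∈ s) (hk : k ∈ s)
    (hiU : v i ∈ U) (hjU : v j ∈ U) (hkU : v k ∈ U) (hij : v j ∉ ℝ ∙ v i)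
    (hijk : v k ∉ span ℝ {v i, v j}) : Even (VectorConfig.flat v s U).card := by
  by_contra hodd
  rw [Nat.not_even_iff_odd] at hodd
  exact hijk ((h.reduced.mono flat_subset).mem_span_pair (h.signBound_one hodd)
    (mem_flat.2 ⟨hi, hiU⟩) (mem_flat.2 ⟨hj, hjU⟩) (mem_flat.2 ⟨hk, hkU⟩) hij)

/-- In the contraction of an odd flat `U`, the classes of odd size lie in a plane. -/
lemma Tight.exists_le_of_odd [FiniteDimensional ℝ E]
    (h : Tight v s) (hU : Odd (VectorConfig.flat v s U).card) :
    ∃ P : Submodule ℝ E, U ≤ P ∧ finrank ℝ P ≤ finrank ℝ U + 2 ∧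
      ∀ j ∈ s, Even (VectorConfig.flat v s (U ⊔ ℝ ∙ v j)).card → v j ∈ P := by
  classical
  -- The contraction by `U` has discrepancy at most 1, so its reduced part `t` has rank at most 2;
  -- `P` is the preimage of its span.
  let w : ι → E ⧸ U := fun i => U.mkQ (v i)
  have hw : ∀ i, w i = U.mkQ (v i) := fun _ => rfl
  have hw0 : ∀ i, w i = 0 ↔ v i ∈ U := fun i => by simp [hw]
  obtain ⟨t, hts, ht, hp⟩ := exists_reduced w (coflat v s U)
    (fun i hi => by rw [Ne, hw0]; exact (mem_coflat.1 hi).2)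
  have hB : SignBound w t 1 := by
    intro f
    have h1 := signSum_sdiff_add (v := w) hts f
    rw [hp.signSum_eq_zero, zero_add] at h1
    have hker : U ≤ LinearMap.ker (f.comp U.mkQ) := by
      intro x hx
      have : U.mkQ x = 0 := by simpa using hx
      simp [this]
    have h2 : signSum w (coflat v s U) f = signSum v s (f.comp U.mkQ) := by
      rw [← signSum_coflat_of_le_ker hker]
      rfl
    rw [h1, h2]
    exact h.abs_le_one hU hker
  refine ⟨(span ℝ (w '' t)).comap U.mkQ, le_comap_mkQ _ _, ?_, fun j hj hje => ?_⟩
  · have h2 := ht.finrank_le_two hB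
    have h1 := LinearMap.finrank_range_add_finrank_ker
      (U.mkQ.domRestrict ((span ℝ (w '' t)).comap U.mkQ))
    have h3 : finrank ℝ (LinearMap.range (U.mkQ.domRestrict ((span ℝ (w '' t)).comap U.mkQ))) ≤
        finrank ℝ (span ℝ (w '' t)) := by
      apply finrank_mono
      rintro _ ⟨x, rfl⟩
      exact x.2
    have h4 : finrank ℝ (LinearMap.ker (U.mkQ.domRestrict ((span ℝ (w '' t)).comap U.mkQ))) ≤
        finrank ℝ U := by
      rw [← Submodule.finrank_map_subtype_eq _ _]
      apply finrank_mono
      rintro _ ⟨x, hx, rfl⟩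
      simpa using hx
    omega
  · by_cases hjU : v j ∈ U
    · exact le_comap_mkQ _ _ hjU
    have hmem : ∀ i, w i ∈ ℝ ∙ w j ↔ v i ∈ U ⊔ ℝ ∙ v j := by
      intro i
      rw [← comap_map_mkQ, mem_comap, map_span, Set.image_singleton]
    -- The direction of `w j` carries an even flat minus the odd flat `U`, an odd number of
    -- elements. Antipodal pairs meet a direction in an even number, so some element of it survives
    -- in `t`.
    have h1 : (VectorConfig.flat w (coflat v s U) (ℝ ∙ w j)).card +
        (VectorConfig.flat v s U).card = (VectorConfig.flat v s (U ⊔ ℝ ∙ v j)).card := by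
      rw [← card_flat_add_card_coflat v (VectorConfig.flat v s (U ⊔ ℝ ∙ v j)) U,
        flat_flat_of_le le_sup_left, add_comm]
      congr 2
      ext i
      simp only [mem_flat, mem_coflat, hmem]
      tauto
    have h2 := card_flat_sdiff_add (v := w) hts (ℝ ∙ w j)
    have h3 := hp.even_card_flat (ℝ ∙ w j)
    have h4 : (VectorConfig.flat w t (ℝ ∙ w j)).Nonempty := by
      rw [← Finset.card_pos, Nat.pos_iff_ne_zero]
      intro h5
      rw [h5, add_zero] at h2
      rw [← h1, ← h2] at hje
      grind
    obtain ⟨i, hi⟩ := h4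
    rw [mem_flat] at hi
    obtain ⟨c, hc⟩ := mem_span_singleton.1 hi.2
    have hc0 : c ≠ 0 := by
      rintro rfl
      exact ht.ne_zero i hi.1 (by rw [← hc, zero_smul])
    rw [mem_comap, ← hw]
    have : w j = c⁻¹ • w i := by rw [← hc, smul_smul, inv_mul_cancel₀ hc0, one_smul]
    rw [this]
    exact smul_mem _ _ (subset_span ⟨i, hi.1, rfl⟩)

end VectorConfig

/-! ### Odd and even lines. -/

namespace VectorConfig

open Module Submodule

section Exchange

variable {E : Type*} [AddCommGroup E] [Module ℝ E] {U W : Submodule ℝ E} {x y z w : E}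

lemma sup_span_singleton_eq (h : y ∈ U ⊔ ℝ ∙ x) (hy : y ∉ U) : U ⊔ ℝ ∙ y = U ⊔ ℝ ∙ x := by
  obtain ⟨u, hu, a, ha, rfl⟩ := mem_sup.1 h
  obtain ⟨c, rfl⟩ := mem_span_singleton.1 ha
  have hc : c ≠ 0 := by rintro rfl; simp [hu] at hy
  apply le_antisymm
  · exact sup_le le_sup_left ((span_singleton_le_iff_mem _ _).2 h)
  · refine sup_le le_sup_left ((span_singleton_le_iff_mem _ _).2 ?_)
    have : x = -(c⁻¹ • u) + c⁻¹ • (u + c • x) := by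
      rw [smul_add, smul_smul, inv_mul_cancel₀ hc, one_smul]; abel
    have h2 : -(c⁻¹ • u) + c⁻¹ • (u + c • x) ∈ U ⊔ ℝ ∙ (u + c • x) :=
      add_mem (mem_sup_left (neg_mem (smul_mem _ _ hu)))
        (mem_sup_right (smul_mem _ _ (mem_span_singleton_self _)))
    rwa [← this] at h2

lemma span_singleton_eq_of_mem (h : y ∈ ℝ ∙ x) (hy : y ≠ 0) : ℝ ∙ y = ℝ ∙ x := by
  have := sup_span_singleton_eq (U := ⊥) (by simpa using h) (by simpa using hy)
  simpa using this

lemma mem_span_singleton_symm (h : y ∈ ℝ ∙ x) (hy : y ≠ 0) : x ∈ ℝ ∙ y := by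
  rw [span_singleton_eq_of_mem h hy]; exact mem_span_singleton_self x

lemma span_singleton_sup_eq (hz : z ∈ ℝ ∙ x ⊔ ℝ ∙ y) (hw : w ∈ ℝ ∙ x ⊔ ℝ ∙ y) (hz0 : z ≠ 0)
    (hzw : w ∉ ℝ ∙ z) : ℝ ∙ z ⊔ ℝ ∙ w = ℝ ∙ x ⊔ ℝ ∙ y := by
  by_cases hxz : z ∈ ℝ ∙ x
  · rw [span_singleton_eq_of_mem hxz hz0] at hzw ⊢
    exact sup_span_singleton_eq hw hzw
  · have h1 := sup_span_singleton_eq hz hxz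
    rw [← h1, sup_comm] at hw ⊢
    rw [sup_comm (ℝ ∙ x)]
    rw [sup_comm] at hw ⊢
    rw [sup_comm (ℝ ∙ x)] at hw
    exact sup_span_singleton_eq hw hzw

lemma exists_dual_of_notMem [FiniteDimensional ℝ E] (hx : x ∉ U) :
    ∃ f : Dual ℝ E, U ≤ LinearMap.ker f ∧ 0 < f x := by
  obtain ⟨f, hf, hf0⟩ := exists_generic (fun _ : Unit => x) {()} U
  have h := hf0 () (by simp) hx
  rcases lt_or_gt_of_ne h with h | h
  · exact ⟨-f, fun y hy => by simpa using hf hy, by simpa using h⟩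
  · exact ⟨f, hf, h⟩

end Exchange

variable {ι E : Type*} [AddCommGroup E] [Module ℝ E]
  {v : ι → E} {s t : Finset ι} {U W : Submodule ℝ E} {f g : Dual ℝ E} {i j k p q : ι}

/-- The span of two vectors of the configuration. -/
abbrev line (v : ι → E) (i j : ι) : Submodule ℝ E := ℝ ∙ v i ⊔ ℝ ∙ v j

lemma left_mem_line : v i ∈ line v i j := mem_sup_left (mem_span_singleton_self _)

lemma right_mem_line : v j ∈ line v i j := mem_sup_right (mem_span_singleton_self _)

lemma line_comm : line v i j = line v j i := sup_comm _ _

lemma span_pair_eq_line : span ℝ {v i, v j} = line v i j := span_insert _ _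

lemma line_le (hi : v i ∈ U) (hj : v j ∈ U) : line v i j ≤ U :=
  sup_le ((span_singleton_le_iff_mem _ _).2 hi) ((span_singleton_le_iff_mem _ _).2 hj)

/-- The span of the independent vectors `v i` and `v j` contains an odd number of elements. -/
def OddLine (v : ι → E) (s : Finset ι) (i j : ι) : Prop :=
  v j ∉ ℝ ∙ v i ∧ Odd (flat v s (line v i j)).card

/-- The span of the independent vectors `v i` and `v j` contains an even number of elements. -/
def EvenLine (v : ι → E) (s : Finset ι) (i j : ι) : Prop :=
  v j ∉ ℝ ∙ v i ∧ Even (flat v s (line v i j)).card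

lemma OddLine.not_evenLine (h : OddLine v s i j) (h' : EvenLine v s p q)
    (heq : line v p q = line v i j) : False := by
  have h1 := h'.2
  rw [heq] at h1
  exact Nat.not_even_iff_odd.2 h.2 h1

lemma oddLine_or_evenLine (s : Finset ι) (h : v j ∉ ℝ ∙ v i) :
    OddLine v s i j ∨ EvenLine v s i j :=
  (Nat.even_or_odd (flat v s (line v i j)).card).symm.imp (⟨h, ·⟩) (⟨h, ·⟩)

lemma notMem_span_symm (h0 : v i ≠ 0) (h : v j ∉ ℝ ∙ v i) : v i ∉ ℝ ∙ v j :=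
  fun h1 => h (mem_span_singleton_symm h1 h0)

lemma OddLine.symm (h0 : v i ≠ 0) (h : OddLine v s i j) : OddLine v s j i :=
  ⟨notMem_span_symm h0 h.1, by rw [line_comm]; exact h.2⟩

lemma EvenLine.symm (h0 : v i ≠ 0) (h : EvenLine v s i j) : EvenLine v s j i :=
  ⟨notMem_span_symm h0 h.1, by rw [line_comm]; exact h.2⟩

lemma OddLine.of_mem (h : OddLine v s i j) (hp : v p ∈ line v i j) (hq : v q ∈ line v i j)
    (hp0 : v p ≠ 0) (hpq : v q ∉ ℝ ∙ v p) : OddLine v s p q :=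
  ⟨hpq, by rw [line, span_singleton_sup_eq hp hq hp0 hpq]; exact h.2⟩

lemma EvenLine.of_mem (h : EvenLine v s i j) (hp : v p ∈ line v i j) (hq : v q ∈ line v i j)
    (hp0 : v p ≠ 0) (hpq : v q ∉ ℝ ∙ v p) : EvenLine v s p q :=
  ⟨hpq, by rw [line, span_singleton_sup_eq hp hq hp0 hpq]; exact h.2⟩

/-- An even line through a point of an odd line leaves the odd line. -/
lemma EvenLine.notMem_line (h : EvenLine v s p k) (h' : OddLine v s i j) (hp : v p ∈ line v i j)
    (hp0 : v p ≠ 0) : v k ∉ line v i j :=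
  fun hk => h'.not_evenLine h (span_singleton_sup_eq hp hk hp0 h.1)

lemma Tight.eq_of_oddLine (h : Tight v s) (hp : p ∈ s) (hpq : OddLine v s p q) (hj : j ∈ s)
    (hj' : v j ∈ ℝ ∙ v p) : p = j :=
  h.eq_of_odd hpq.2 hp left_mem_line hj hj'

lemma Tight.flat_singleton_eq (h : Tight v s) (hp : p ∈ s) (hpq : OddLine v s p q) :
    VectorConfig.flat v s (ℝ ∙ v p) = {p} := by
  ext j
  simp only [mem_flat, Finset.mem_singleton]
  refine ⟨fun hj => (h.eq_of_oddLine hp hpq hj.1 hj.2).symm, ?_⟩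
  rintro rfl
  exact ⟨hp, mem_span_singleton_self _⟩

lemma Tight.odd_card_flat_singleton (h : Tight v s) (hp : p ∈ s) (hpq : OddLine v s p q) :
    Odd (VectorConfig.flat v s (ℝ ∙ v p)).card := by
  simp [h.flat_singleton_eq hp hpq]

/-- An odd line contains a third point. -/
lemma Tight.exists_third_of_oddLine (h : Tight v s) (hp : p ∈ s) (hq : q ∈ s)
    (hpq : OddLine v s p q) :
    ∃ k ∈ s, v k ∈ line v p q ∧ v k ∉ ℝ ∙ v p ∧ v k ∉ ℝ ∙ v q := by
  have hne : p ≠ q := by rintro rfl; exact hpq.1 (mem_span_singleton_self _)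
  obtain ⟨k, hk, hkp, hkq⟩ := exists_mem_of_odd_of_two hpq.2 (mem_flat.2 ⟨hp, left_mem_line⟩)
    (mem_flat.2 ⟨hq, right_mem_line⟩) hne
  rw [mem_flat] at hk
  exact ⟨k, hk.1, hk.2, fun h1 => hkp (h.eq_of_oddLine hp hpq hk.1 h1).symm,
    fun h1 => hkq (h.eq_of_oddLine hq (hpq.symm (h.reduced.ne_zero p hp)) hk.1 h1).symm⟩

/-- A plane through a repeated direction contains a third one. -/
lemma Tight.exists_third_of_two_le [FiniteDimensional ℝ E] (h : Tight v s) (hp : p ∈ s) (hq : q ∈ s)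
    (hpq : v q ∉ ℝ ∙ v p) (h2 : 2 ≤ (VectorConfig.flat v s (ℝ ∙ v p)).card) :
    ∃ k ∈ s, v k ∈ line v p q ∧ v k ∉ ℝ ∙ v p ∧ v k ∉ ℝ ∙ v q := by
  classical
  by_contra! hcon
  obtain ⟨f, hf, hfq⟩ := exists_dual_of_notMem hpq
  obtain ⟨g, hg, hgp⟩ := exists_dual_of_notMem (notMem_span_symm (h.reduced.ne_zero p hp) hpq)
  have hfp : f (v p) = 0 := hf (mem_span_singleton_self _)
  have hgq : g (v q) = 0 := hg (mem_span_singleton_self _)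
  -- Without a third direction `f + g` is positive on the whole flat, which contains the repeated
  -- direction and `q`: at least three elements against the bound 2.
  have h1 := (h.bound.flat (line v p q)) (f + g)
  rw [signSum_of_pos] at h1
  · have hsub : insert q (VectorConfig.flat v s (ℝ ∙ v p)) ⊆
        VectorConfig.flat v s (line v p q) := by
      intro k hk
      rw [Finset.mem_insert, mem_flat] at hk
      rcases hk with rfl | hk
      · exact mem_flat.2 ⟨hq, right_mem_line⟩
      · exact mem_flat.2 ⟨hk.1, mem_sup_left hk.2⟩
    have h3 := Finset.card_le_card hsub
    rw [Finset.card_insert_of_notMem (fun hq' => hpq (mem_flat.1 hq').2)] at h3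
    have h4 : ((VectorConfig.flat v s (line v p q)).card : ℤ) ≤ 2 := by simpa using h1
    omega
  · intro k hk
    rw [mem_flat] at hk
    by_cases hkp : v k ∈ ℝ ∙ v p
    · exact h.reduced.pos_of_mem_span hp hk.1 hkp (by simp [hfp, hgp])
    · exact h.reduced.pos_of_mem_span hq hk.1 (hcon k hk.1 hk.2 hkp) (by simp [hgq, hfq])

/-- The Sylvester–Gallai theorem for a subconfiguration. -/
lemma mem_line_of_no_ordinary_line [FiniteDimensional ℝ E] (h0 : ∀ i ∈ s, v i ≠ 0)
    (h : ∀ i ∈ s, ∀ j ∈ s, v j ∉ ℝ ∙ v i →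
      ∃ k ∈ s, v k ∈ line v i j ∧ v k ∉ ℝ ∙ v i ∧ v k ∉ ℝ ∙ v j)
    (hi : i ∈ s) (hj : j ∈ s) (hk : k ∈ s) (hij : v j ∉ ℝ ∙ v i) : v k ∈ line v i j := by
  rw [← span_pair_eq_line]
  refine mem_span_pair_of_no_ordinary_plane (A := v '' s) (s.finite_toSet.image v) ?_ ?_
    ⟨i, hi, rfl⟩ ⟨j, hj, rfl⟩ ⟨k, hk, rfl⟩ hij
  · rintro _ ⟨i, hi, rfl⟩; exact h0 i hi
  · rintro _ ⟨i, hi, rfl⟩ _ ⟨j, hj, rfl⟩ hij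
    obtain ⟨k, hk, h1, h2, h3⟩ := h i hi j hj hij
    exact ⟨v k, ⟨k, hk, rfl⟩, by rwa [span_pair_eq_line], h2, h3⟩

/-! ### Planar configurations with a point on no odd line. -/

/-- A planar configuration in which every point of an odd line lies on exactly one even line. -/
structure Planar (v : ι → E) (t : Finset ι) : Prop where
  tight : Tight v t
  mem_sup : ∀ p ∈ t, ∀ q ∈ t, OddLine v t p q → ∀ m ∈ t, v m ∉ line v p q → ∀ i ∈ t,
    v i ∈ line v p q ⊔ ℝ ∙ v m
  exists_evenLine : ∀ p ∈ t, ∀ q ∈ t, OddLine v t p q → ∃ j ∈ t, EvenLine v t p j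
  line_eq : ∀ p ∈ t, ∀ q ∈ t, OddLine v t p q → ∀ j ∈ t, ∀ j' ∈ t,
    EvenLine v t p j → EvenLine v t p j' → line v p j = line v p j'

namespace Planar

lemma ne_zero (h : Planar v t) (hi : i ∈ t) : v i ≠ 0 := h.tight.reduced.ne_zero i hi

section EvenPoint

variable {a : ι}

/-- If all lines through `a` are even, then all other points lie on odd lines. -/
lemma exists_oddLine (h : Planar v t) (hp : p ∈ t) (hq : q ∈ t) (hpq : OddLine v t p q)
    (ha : a ∈ t) (hae : ∀ j ∈ t, v j ∉ ℝ ∙ v a → EvenLine v t a j) (hi : i ∈ t)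
    (hia : v i ∉ ℝ ∙ v a) : ∃ j ∈ t, OddLine v t i j := by
  by_contra! hcon
  have hie : ∀ j ∈ t, v j ∉ ℝ ∙ v i → EvenLine v t i j := fun j hj hij =>
    (oddLine_or_evenLine t hij).resolve_left (hcon j hj)
  have aux : ∀ b ∈ t, (∀ j ∈ t, v j ∉ ℝ ∙ v b → EvenLine v t b j) → ∀ x ∈ t, ∀ y ∈ t,
      OddLine v t x y → EvenLine v t x b := by
    intro b hb hbe x hx y hy hxy
    by_cases hbx : v x ∈ ℝ ∙ v b
    · exfalso
      have e := span_singleton_eq_of_mem hbx (h.ne_zero hx)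
      have h1 := hbe y hy (by rw [← e]; exact hxy.1)
      exact hxy.not_evenLine h1 (by rw [line, line, e])
    · exact (hbe x hx hbx).symm (h.ne_zero hb)
  have hqp := hpq.symm (h.ne_zero hp)
  -- With two such points `a` and `i`, the unique even line of `p` passes through both, and so does
  -- that of `q`. Both would be the line `a i`, and then also the odd line `p q`.
  have e1 := h.line_eq p hp q hq hpq a ha i hi (aux a ha hae p hp q hq hpq)
    (aux i hi hie p hp q hq hpq)
  have e2 := h.line_eq q hq p hp hqp a ha i hi (aux a ha hae q hq p hp hqp)
    (aux i hi hie q hq p hp hqp)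
  have m1 : v i ∈ line v p a := by rw [e1]; exact right_mem_line
  have m2 : v i ∈ line v q a := by rw [e2]; exact right_mem_line
  have f1 : line v a i = line v p a := span_singleton_sup_eq right_mem_line m1 (h.ne_zero ha) hia
  have f2 : line v a i = line v q a := span_singleton_sup_eq right_mem_line m2 (h.ne_zero ha) hia
  refine (aux a ha hae q hq p hp hqp).notMem_line hqp left_mem_line (h.ne_zero hq) ?_
  have : line v q p = line v p a := by
    rw [line_comm]
    exact span_singleton_sup_eq left_mem_line (show v q ∈ line v p a by rw [← f1, f2]; exact left_mem_line)
      (h.ne_zero hp) hpq.1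
  rw [this]
  exact right_mem_line

/-- The unique even line of any point other than `a` goes through `a`, so lines avoiding `a` are odd
and have a third point. Sylvester–Gallai then applies to all of `t` or to `t` without the direction
of `a`, according to the parity of the multiplicity of `a`. -/
lemma eq_evenPoint_of_notMem_line [FiniteDimensional ℝ E]
    (h : Planar v t) (hp : p ∈ t) (hq : q ∈ t)
    (hpq : OddLine v t p q) (ha : a ∈ t) (hae : ∀ j ∈ t, v j ∉ ℝ ∙ v a → EvenLine v t a j)
    {m : ι} (hm : m ∈ t) (hmpq : v m ∉ line v p q) : m = a := by
  have hodd : ∀ i ∈ t, v i ∉ ℝ ∙ v a → ∃ j ∈ t, OddLine v t i j := fun i hi hia =>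
    h.exists_oddLine hp hq hpq ha hae hi hia
  have hline : ∀ i ∈ t, ∀ j ∈ t, v i ∉ ℝ ∙ v a → v j ∉ ℝ ∙ v i → v a ∉ line v i j →
      OddLine v t i j := by
    intro i hi j hj hia hij haij
    refine (oddLine_or_evenLine t hij).resolve_right fun he => haij ?_
    obtain ⟨k, hk, hik⟩ := hodd i hi hia
    rw [h.line_eq i hi k hk hik j hj a ha he ((hae i hi hia).symm (h.ne_zero ha))]
    exact right_mem_line
  have hpa : ∀ x ∈ t, ∀ y ∈ t, OddLine v t x y → v x ∉ ℝ ∙ v a := by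
    intro x hx y hy hxy hxa
    have e := span_singleton_eq_of_mem hxa (h.ne_zero hx)
    have h1 := hae y hy (by rw [← e]; exact hxy.1)
    exact hxy.not_evenLine h1 (by rw [line, line, e])
  have hp' := hpa p hp q hq hpq
  have hq' := hpa q hq p hp (hpq.symm (h.ne_zero hp))
  rcases Nat.even_or_odd (VectorConfig.flat v t (ℝ ∙ v a)).card with hev | hod
  · have h2 : 2 ≤ (VectorConfig.flat v t (ℝ ∙ v a)).card := by
      have : 0 < (VectorConfig.flat v t (ℝ ∙ v a)).card :=
        Finset.card_pos.2 ⟨a, mem_flat.2 ⟨ha, mem_span_singleton_self _⟩⟩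
      rcases hev with ⟨n, hn⟩; omega
    -- Here `a` is a repeated direction, so lines through it have third points too, and all of `t`
    -- would be collinear.
    refine absurd ?_ hmpq
    refine mem_line_of_no_ordinary_line (fun i hi => h.ne_zero hi) ?_ hp hq hm hpq.1
    intro i hi j hj hij
    by_cases hia : v i ∈ ℝ ∙ v a
    · refine h.tight.exists_third_of_two_le hi hj hij ?_
      rwa [span_singleton_eq_of_mem hia (h.ne_zero hi)]
    by_cases hja : v j ∈ ℝ ∙ v a
    · obtain ⟨k, hk, h3, h4, h5⟩ := h.tight.exists_third_of_two_le hj hi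
        (notMem_span_symm (h.ne_zero hi) hij)
        (by rwa [span_singleton_eq_of_mem hja (h.ne_zero hj)])
      exact ⟨k, hk, by rwa [line_comm], h5, h4⟩
    by_cases haij : v a ∈ line v i j
    · exact ⟨a, ha, haij, fun h'' => hia (mem_span_singleton_symm h'' (h.ne_zero ha)),
        fun h'' => hja (mem_span_singleton_symm h'' (h.ne_zero ha))⟩
    · exact h.tight.exists_third_of_oddLine hi hj (hline i hi j hj hia hij haij)
  · have hma : v m ∈ ℝ ∙ v a := by
      by_contra hma
      refine hmpq (mem_line_of_no_ordinary_line (s := coflat v t (ℝ ∙ v a))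
        (fun i hi => h.ne_zero (coflat_subset hi)) ?_ (mem_coflat.2 ⟨hp, hp'⟩)
        (mem_coflat.2 ⟨hq, hq'⟩) (mem_coflat.2 ⟨hm, hma⟩) hpq.1)
      intro i hi j hj hij
      rw [mem_coflat] at hi hj
      obtain ⟨hi, hia⟩ := hi
      obtain ⟨hj, hja⟩ := hj
      by_cases haij : v a ∈ line v i j
      · have e : line v a i = line v i j := span_singleton_sup_eq haij left_mem_line
          (h.ne_zero ha) hia
        have h1 := (hae i hi hia).2
        have h2 := card_flat_add_card_coflat v (VectorConfig.flat v t (line v a i)) (ℝ ∙ v a)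
        rw [flat_flat_of_le le_sup_left] at h2
        have h3 : Odd (coflat v (VectorConfig.flat v t (line v a i)) (ℝ ∙ v a)).card := by
          rw [← h2] at h1; grind
        obtain ⟨k, hk, hki, hkj⟩ := exists_mem_of_odd_of_two h3
          (i := i) (j := j) (by simp [hi, hia, right_mem_line])
          (by rw [e]; simp [hj, hja, right_mem_line])
          (by rintro rfl; exact hij (mem_span_singleton_self _))
        simp only [mem_coflat, mem_flat] at hk
        obtain ⟨i', hi', hii'⟩ := hodd i hi hia
        obtain ⟨j', hj', hjj'⟩ := hodd j hj hja
        exact ⟨k, mem_coflat.2 ⟨hk.1.1, hk.2⟩, e ▸ hk.1.2,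
          fun h'' => hki (h.tight.eq_of_oddLine hi hii' hk.1.1 h'').symm,
          fun h'' => hkj (h.tight.eq_of_oddLine hj hjj' hk.1.1 h'').symm⟩
      · obtain ⟨k, hk, h3, h4, h5⟩ :=
          h.tight.exists_third_of_oddLine hi hj (hline i hi j hj hia hij haij)
        refine ⟨k, mem_coflat.2 ⟨hk, fun hka => haij ?_⟩, h3, h4, h5⟩
        exact (span_singleton_le_iff_mem _ _).2 h3 (mem_span_singleton_symm hka (h.ne_zero hk))
    exact (h.tight.eq_of_odd hod ha (mem_span_singleton_self _) hm hma).symm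

end EvenPoint

end Planar

end VectorConfig

/-! ### The centre of an odd line and the existence of an even point. -/

namespace VectorConfig

open Module Submodule

variable {ι E : Type*} [AddCommGroup E] [Module ℝ E]
  {v : ι → E} {s t : Finset ι} {U W : Submodule ℝ E} {f g : Dual ℝ E} {i j k p q : ι}

/-- Composition of covectors inside the contraction by `U`, where the bound is 1. -/
lemma Tight.abs_add_abs_le_one (h : Tight v s) (hU : Odd (VectorConfig.flat v s U).card)
    (hf : U ≤ LinearMap.ker f) (hg : U ≤ LinearMap.ker g) :
    |signSum v s f| + |signSum v (VectorConfig.flat v s (LinearMap.ker f)) g| ≤ 1 := by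
  have key : ∀ g : Dual ℝ E, U ≤ LinearMap.ker g →
      |signSum v s f + signSum v (VectorConfig.flat v s (LinearMap.ker f)) g| ≤ 1 := by
    intro g hg
    obtain ⟨ε, -, -, -, h1⟩ := signSum_perturb v s f g
    rw [← h1]
    refine h.abs_le_one hU fun x hx => ?_
    have h2 : f x = 0 := hf hx
    have h3 : g x = 0 := hg hx
    simp [h2, h3]
  have h1 := key g hg
  have h2 := key (-g) fun x hx => by simpa using hg hx
  rw [signSum_neg] at h2
  grind

namespace Planar

/-- The kernels of `g - r • f` cut out the pencil of lines through `i`. For `r ≠ 0` such a line is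
neither the odd line `p q` nor the unique even line of `i`, so it is empty off `i` or is an odd line
from which exactly `i` is removed. -/
lemma even_card_fiber (h : Planar v t) (hpq : OddLine v t p q)
    (hi : i ∈ t) (hipq : v i ∈ line v p q) (hj : j ∈ t) (hij : EvenLine v t i j)
    (hf : line v p q ≤ LinearMap.ker f) (hf' : ∀ k ∈ t, v k ∉ line v p q → f (v k) ≠ 0)
    (hg : line v i j ≤ LinearMap.ker g) {r : ℝ} (hr : r ≠ 0) (hi' : ∃ i' ∈ t, OddLine v t i i') :
    Even (coflat v (VectorConfig.flat v t (LinearMap.ker (g - r • f))) (line v p q)).card := by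
  rcases (coflat v (VectorConfig.flat v t (LinearMap.ker (g - r • f)))
    (line v p q)).eq_empty_or_nonempty with h0 | ⟨k₀, hk₀⟩
  · simp [h0]
  obtain ⟨i', hi't, hii'⟩ := hi'
  simp only [mem_coflat, mem_flat, LinearMap.mem_ker, LinearMap.sub_apply,
    LinearMap.smul_apply, smul_eq_mul] at hk₀
  obtain ⟨⟨hk₀, hgf⟩, hkU⟩ := hk₀
  have hi0 := h.ne_zero hi
  have hgi : g (v i) = 0 := hg left_mem_line
  have hgj : g (v j) = 0 := hg right_mem_line
  have hfi : f (v i) = 0 := hf hipq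
  have hfk := hf' k₀ hk₀ hkU
  have hnot : ∀ k, v k ∉ line v p q → v k ∉ ℝ ∙ v i := fun k hk hki =>
    hk ((span_singleton_le_iff_mem _ _).2 hipq hki)
  have hodd : OddLine v t i k₀ := by
    refine (oddLine_or_evenLine t (hnot k₀ hkU)).resolve_right fun he => ?_
    have h1 := h.line_eq i hi i' hi't hii' k₀ hk₀ j hj he hij
    have h2 : g (v k₀) = 0 := hg (h1 ▸ right_mem_line)
    rw [h2, zero_sub, neg_eq_zero] at hgf
    exact (mul_ne_zero hr hfk) hgf
  have hfj : f (v j) ≠ 0 := hf' j hj (hij.notMem_line hpq hipq hi0)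
  have hset : coflat v (VectorConfig.flat v t (LinearMap.ker (g - r • f))) (line v p q) =
      coflat v (VectorConfig.flat v t (line v i k₀)) (ℝ ∙ v i) := by
    ext k
    simp only [mem_coflat, mem_flat, LinearMap.mem_ker, LinearMap.sub_apply,
      LinearMap.smul_apply, smul_eq_mul]
    constructor
    · rintro ⟨⟨hk, hgk⟩, hkpq⟩
      refine ⟨⟨hk, ?_⟩, hnot k hkpq⟩
      by_contra hcon
      have h1 := h.mem_sup i hi k₀ hk₀ hodd k hk hcon j hj
      have h2 : line v i k₀ ⊔ ℝ ∙ v k ≤ LinearMap.ker (g - r • f) := by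
        refine sup_le (line_le ?_ ?_) ((span_singleton_le_iff_mem _ _).2 ?_)
        · simp [hgi, hfi]
        · simpa using hgf
        · simpa using hgk
      have h3 := h2 h1
      simp only [LinearMap.mem_ker, LinearMap.sub_apply, LinearMap.smul_apply, smul_eq_mul, hgj,
        zero_sub, neg_eq_zero] at h3
      exact mul_ne_zero hr hfj h3
    · rintro ⟨⟨hk, hkl⟩, hki⟩
      refine ⟨⟨hk, ?_⟩, fun hkpq => hkU ?_⟩
      · have h2 : line v i k₀ ≤ LinearMap.ker (g - r • f) := by
          refine line_le ?_ ?_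
          · simp [hgi, hfi]
          · simpa using hgf
        simpa using h2 hkl
      · have h4 : line v i k = line v i k₀ := span_singleton_sup_eq left_mem_line hkl hi0 hki
        exact (line_le hipq hkpq : line v i k ≤ line v p q) (h4 ▸ right_mem_line)
  rw [hset]
  have h5 := card_flat_add_card_coflat v (VectorConfig.flat v t (line v i k₀)) (ℝ ∙ v i)
  rw [flat_flat_of_le le_sup_left, h.tight.flat_singleton_eq hi hodd, Finset.card_singleton] at h5
  have h6 := hodd.2
  rw [← h5] at h6
  grind

/-- The even lines through the points of an odd line are concurrent. -/
lemma exists_center [FiniteDimensional ℝ E]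
    (h : Planar v t) (hp : p ∈ t) (hq : q ∈ t) (hpq : OddLine v t p q) :
    ∃ c : E, c ≠ 0 ∧ ∀ i ∈ t, v i ∈ line v p q → ∀ j ∈ t, EvenLine v t i j → c ∈ line v i j := by
  classical
  obtain ⟨f, hf, hf'⟩ := exists_generic v t (line v p q)
  set T := coflat v t (line v p q) with hT
  have hfT : ∀ k ∈ T, f (v k) ≠ 0 := fun k hk => hf' k (mem_coflat.1 hk).1 (mem_coflat.1 hk).2
  have happly : ∀ g : Dual ℝ E, g (∑ k ∈ T, |f (v k)|⁻¹ • v k) =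
      ∑ k ∈ T, g (v k) / f (v k) * ((SignType.sign (f (v k)) : ℤ) : ℝ) := by
    intro g
    rw [map_sum]
    refine Finset.sum_congr rfl fun k hk => ?_
    rw [map_smul, smul_eq_mul]
    rcases lt_or_gt_of_ne (hfT k hk) with h1 | h1
    · rw [abs_of_neg h1, sign_neg h1]
      simp; field_simp
    · rw [abs_of_pos h1, sign_pos h1]
      simp; field_simp
  -- In the chart `f = 1` this is the sum of the points off the odd line, weighted by the signs of
  -- `f`. Its `f`-value is a generic count on an odd set, hence nonzero.
  refine ⟨∑ k ∈ T, |f (v k)|⁻¹ • v k, fun h0 => ?_, fun i hi hipq j hj hij => ?_⟩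
  · have h1 := happly f
    rw [h0, map_zero, Finset.sum_congr rfl fun k hk => by rw [div_self (hfT k hk), one_mul]] at h1
    have h2 : signSum v T f % 2 = _ := signSum_emod_two hfT
    have h3 : signSum v T f = 0 := by unfold signSum; exact_mod_cast h1.symm
    obtain ⟨m, hm⟩ := h.tight.odd_coflat hpq.2
    rw [h3, hT, hm] at h2
    push_cast at h2
    omega
  · by_contra hcon
    have hi' : ∃ i' ∈ t, OddLine v t i i' := by
      by_cases hip : v p ∈ ℝ ∙ v i
      · refine ⟨q, hq, hpq.of_mem hipq right_mem_line (h.ne_zero hi) fun h1 => hpq.1 ?_⟩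
        rwa [span_singleton_eq_of_mem hip (h.ne_zero hp)]
      · exact ⟨p, hp, hpq.of_mem hipq left_mem_line (h.ne_zero hi) hip⟩
    obtain ⟨g, hg, hgc⟩ := exists_dual_of_notMem hcon
    rw [happly] at hgc
    refine hgc.ne' ?_
    -- Sort the terms by the lines of the pencil through `i`. The line `r = 0` contributes nothing;
    -- on any other the signed count is even and bounded by 1, hence 0. So `g` vanishes at the
    -- centre.
    rw [← Finset.sum_fiberwise_of_maps_to
      (t := T.image fun k => g (v k) / f (v k)) (g := fun k => g (v k) / f (v k))
      fun k hk => Finset.mem_image_of_mem _ hk]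
    refine Finset.sum_eq_zero fun r _ => ?_
    by_cases hr : r = 0
    · refine Finset.sum_eq_zero fun k hk => ?_
      rw [(Finset.mem_filter.1 hk).2, hr, zero_mul]
    have hset : T.filter (fun k => g (v k) / f (v k) = r) =
        coflat v (VectorConfig.flat v t (LinearMap.ker (g - r • f))) (line v p q) := by
      ext k
      simp only [hT, Finset.mem_filter, mem_coflat, mem_flat, LinearMap.mem_ker,
        LinearMap.sub_apply, LinearMap.smul_apply, smul_eq_mul]
      constructor
      · rintro ⟨⟨h1, h2⟩, h3⟩
        rw [div_eq_iff (hf' k h1 h2)] at h3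
        exact ⟨⟨h1, by rw [h3, sub_self]⟩, h2⟩
      · rintro ⟨⟨h1, h3⟩, h2⟩
        refine ⟨⟨h1, h2⟩, ?_⟩
        rw [div_eq_iff (hf' k h1 h2)]
        linarith
    have h1 := h.even_card_fiber hpq hi hipq hj hij hf hf' hg hr hi'
    obtain ⟨i', hi't, hii'⟩ := hi'
    have h2 := h.tight.abs_add_abs_le_one (h.tight.odd_card_flat_singleton hi hii')
      (f := g - r • f) (g := f) (by
        rw [span_singleton_le_iff_mem]
        have e1 : g (v i) = 0 := hg left_mem_line
        have e2 : f (v i) = 0 := hf hipq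
        simp [e1, e2]) ((span_singleton_le_iff_mem _ _).2 (hf hipq))
    rw [← signSum_coflat_of_le_ker hf (s := VectorConfig.flat v t _), ← hset] at h2
    rw [← hset] at h1
    have h3 : signSum v (T.filter fun k => g (v k) / f (v k) = r) f % 2 = _ :=
      signSum_emod_two fun k hk => hfT k (Finset.mem_of_mem_filter k hk)
    have h4 : signSum v (T.filter fun k => g (v k) / f (v k) = r) f = 0 := by
      have := abs_nonneg (signSum v t (g - r • f))
      obtain ⟨m, hm⟩ := h1
      rw [hm] at h3
      grind
    calc ∑ k ∈ T with g (v k) / f (v k) = r,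
          g (v k) / f (v k) * ((SignType.sign (f (v k)) : ℤ) : ℝ)
        = ∑ k ∈ T with g (v k) / f (v k) = r, r * ((SignType.sign (f (v k)) : ℤ) : ℝ) :=
          Finset.sum_congr rfl fun k hk => by rw [(Finset.mem_filter.1 hk).2]
      _ = r * (signSum v (T.filter fun k => g (v k) / f (v k) = r) f : ℝ) := by
          rw [← Finset.mul_sum]; unfold signSum; push_cast; rfl
      _ = 0 := by rw [h4]; simp

/-- Some point of a planar configuration lies on no odd line. -/
lemma exists_evenPoint [FiniteDimensional ℝ E]
    (h : Planar v t) (hp : p ∈ t) (hq : q ∈ t) (hpq : OddLine v t p q) :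
    ∃ a ∈ t, ∀ j ∈ t, v j ∉ ℝ ∙ v a → EvenLine v t a j := by
  classical
  by_contra! hcon
  have hodd : ∀ i ∈ t, ∃ j ∈ t, OddLine v t i j := by
    intro i hi
    obtain ⟨j, hj, hij, hne⟩ := hcon i hi
    exact ⟨j, hj, (oddLine_or_evenLine t hij).resolve_right hne⟩
  have heven : ∀ i ∈ t, ∃ j ∈ t, EvenLine v t i j := fun i hi => by
    obtain ⟨j, hj, hij⟩ := hodd i hi
    exact h.exists_evenLine i hi j hj hij
  have huniq : ∀ i ∈ t, ∀ j ∈ t, ∀ j' ∈ t, EvenLine v t i j → EvenLine v t i j' →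
      line v i j = line v i j' := fun i hi => by
    obtain ⟨j, hj, hij⟩ := hodd i hi
    exact h.line_eq i hi j hj hij
  have hinj : ∀ i ∈ t, ∀ j ∈ t, v j ∈ ℝ ∙ v i → i = j := fun i hi j hj hij => by
    obtain ⟨k, hk, hik⟩ := hodd i hi
    exact h.tight.eq_of_oddLine hi hik hj hij
  have hqp := hpq.symm (h.ne_zero hp)
  obtain ⟨z, hz0, hz⟩ := h.exists_center hp hq hpq
  obtain ⟨a, ha, hpa⟩ := heven p hp
  obtain ⟨b, hb, hqb⟩ := heven q hq
  have hza := hz p hp left_mem_line a ha hpa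
  have hzb := hz q hq right_mem_line b hb hqb
  -- A point at `z` would be on the even lines of `p` and `q` and differ from both, so its own
  -- unique even line would contain `p` and `q`.
  have hzi : ∀ i ∈ t, z ∉ ℝ ∙ v i := by
    intro i hi hzi
    have hiz := mem_span_singleton_symm hzi hz0
    have hia : v i ∈ line v p a := (span_singleton_le_iff_mem _ _).2 hza hiz
    have hib : v i ∈ line v q b := (span_singleton_le_iff_mem _ _).2 hzb hiz
    have hip : v i ∉ ℝ ∙ v p := fun h1 => by
      obtain rfl := hinj p hp i hi h1
      have h2 := hqb.of_mem left_mem_line hib (h.ne_zero hq) hqp.1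
      exact hqp.not_evenLine h2 rfl
    have hiq : v i ∉ ℝ ∙ v q := fun h1 => by
      obtain rfl := hinj q hq i hi h1
      have h2 := hpa.of_mem left_mem_line hia (h.ne_zero hp) hpq.1
      exact hpq.not_evenLine h2 rfl
    have h1 := (hpa.of_mem left_mem_line hia (h.ne_zero hp) hip).symm (h.ne_zero hp)
    have h2 := (hqb.of_mem left_mem_line hib (h.ne_zero hq) hiq).symm (h.ne_zero hq)
    have h3 := huniq i hi p hp q hq h1 h2
    exact hpq.not_evenLine (h1.of_mem right_mem_line (by rw [h3]; exact right_mem_line)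
      (h.ne_zero hp) hpq.1) rfl
  -- The centre together with all points whose even line passes through it. This set has no ordinary
  -- line, so Sylvester–Gallai would place `a` on the line `p q`, which the even line `p a` leaves.
  let A : Set E := insert z (v '' {i | i ∈ t ∧ ∀ j ∈ t, EvenLine v t i j → z ∈ line v i j})
  have hpair : ∀ i ∈ t, (∀ j ∈ t, EvenLine v t i j → z ∈ line v i j) →
      ∃ x ∈ A, x ∈ span ℝ {v i, z} ∧ x ∉ ℝ ∙ v i ∧ x ∉ ℝ ∙ z := by
    intro i hi hiz
    obtain ⟨j, hj, hij⟩ := heven i hi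
    have hji := hij.symm (h.ne_zero hi)
    refine ⟨v j, Or.inr ⟨j, ⟨hj, fun k hk hjk => ?_⟩, rfl⟩, ?_, hij.1, fun h1 => ?_⟩
    · rw [← huniq j hj i hi k hk hji hjk, line_comm]
      exact hiz j hj hij
    · have h1 := sup_span_singleton_eq (hiz j hj hij) (hzi i hi)
      rw [span_insert, h1]
      exact right_mem_line
    · exact hzi j hj (mem_span_singleton_symm h1 (h.ne_zero hj))
  have hA : A.Finite := ((t.finite_toSet.subset fun i hi => hi.1).image v).insert z
  refine hpa.notMem_line hpq left_mem_line (h.ne_zero hp) ?_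
  rw [← span_pair_eq_line]
  have hcenter : ∀ i ∈ t, v i ∈ line v p q → ∀ j ∈ t, EvenLine v t i j → v j ∈ A :=
    fun i hi hil j hj hij => Or.inr ⟨j, ⟨hj, fun k hk hjk => by
      rw [← huniq j hj i hi k hk (hij.symm (h.ne_zero hi)) hjk, line_comm]
      exact hz i hi hil j hj hij⟩, rfl⟩
  refine mem_span_pair_of_no_ordinary_plane hA ?_ ?_
    (Or.inr ⟨p, ⟨hp, hz p hp left_mem_line⟩, rfl⟩)
    (Or.inr ⟨q, ⟨hq, hz q hq right_mem_line⟩, rfl⟩) (hcenter p hp left_mem_line a ha hpa) hpq.1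
  · rintro x (rfl | ⟨i, hi, rfl⟩)
    · exact hz0
    · exact h.ne_zero hi.1
  · rintro x (rfl | ⟨i, hi, rfl⟩) y (rfl | ⟨j, hj, rfl⟩) hxy
    · exact absurd (mem_span_singleton_self _) hxy
    · obtain ⟨k, hk, h1, h2, h3⟩ := hpair j hj.1 hj.2
      exact ⟨k, hk, by rwa [Set.pair_comm], h3, h2⟩
    · exact hpair i hi.1 hi.2
    · rcases oddLine_or_evenLine t hxy with ho | he
      · obtain ⟨k, hk, h1, h2, h3⟩ := h.tight.exists_third_of_oddLine hi.1 hj.1 ho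
        obtain ⟨c, hc0, hc⟩ := h.exists_center hi.1 hj.1 ho
        obtain ⟨i', hi', hii'⟩ := heven i hi.1
        obtain ⟨j', hj', hjj'⟩ := heven j hj.1
        have c1 := hc i hi.1 left_mem_line i' hi' hii'
        have c2 := hc j hj.1 right_mem_line j' hj' hjj'
        have z1 := hi.2 i' hi' hii'
        have z2 := hj.2 j' hj' hjj'
        -- The even lines of `i` and `j` are distinct and both contain `c` and `z`. Hence `z` is
        -- also the centre of the odd line `i j`, and the third point `k` belongs to `A`.
        have hzc : z ∈ ℝ ∙ c := by
          by_contra hzc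
          have e1 := span_singleton_sup_eq c1 z1 hc0 hzc
          have e2 := span_singleton_sup_eq c2 z2 hc0 hzc
          have h4 : v j ∈ line v i i' := by
            rw [line, ← e1, e2]; exact left_mem_line
          exact ho.not_evenLine (hii'.of_mem left_mem_line h4 (h.ne_zero hi.1) ho.1) rfl
        refine ⟨v k, Or.inr ⟨k, ⟨hk, fun k' hk' hkk' => ?_⟩, rfl⟩, by rwa [span_pair_eq_line],
          h2, h3⟩
        exact (span_singleton_le_iff_mem _ _).2 (hc k hk h1 k' hk' hkk') hzc
      · refine ⟨z, Or.inl rfl, ?_, hzi i hi.1, hzi j hj.1⟩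
        rw [span_pair_eq_line]
        exact hi.2 j hj.1 he

/-- A planar configuration has just one point outside an odd line. -/
lemma eq_of_notMem_line [FiniteDimensional ℝ E]
    (h : Planar v t) (hp : p ∈ t) (hq : q ∈ t) (hpq : OddLine v t p q)
    (hi : i ∈ t) (hj : j ∈ t) (hi' : v i ∉ line v p q) (hj' : v j ∉ line v p q) : i = j := by
  obtain ⟨a, ha, hae⟩ := h.exists_evenPoint hp hq hpq
  rw [h.eq_evenPoint_of_notMem_line hp hq hpq ha hae hi hi',
    h.eq_evenPoint_of_notMem_line hp hq hpq ha hae hj hj']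

end Planar

end VectorConfig

/-! ### Discrepancy two in rank at least four. -/

namespace VectorConfig

open Module Submodule

variable {ι E : Type*} [AddCommGroup E] [Module ℝ E]
  {v : ι → E} {s t : Finset ι} {U W : Submodule ℝ E} {f g : Dual ℝ E} {i j k m p q : ι}

namespace Tight

lemma even_plane [FiniteDimensional ℝ E]
    (h : Tight v s) (hp : p ∈ s) (hq : q ∈ s) (hm : m ∈ s) (hpq : v q ∉ ℝ ∙ v p)
    (hmpq : v m ∉ line v p q) : Even (VectorConfig.flat v s (line v p q ⊔ ℝ ∙ v m)).card :=
  h.even_of_indep hp hq hm (mem_sup_left left_mem_line) (mem_sup_left right_mem_line)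
    (mem_sup_right (mem_span_singleton_self _)) hpq (by rwa [span_pair_eq_line])

/-- The number of elements of `W` off the odd line is odd. Were all lines through `p` in `W` odd,
each would contribute an even number, since `p` has multiplicity one. -/
lemma exists_evenLine (h : Tight v s) (hp : p ∈ s) (hpq : OddLine v s p q)
    (hW : line v p q ≤ W) (hWe : Even (VectorConfig.flat v s W).card) :
    ∃ j ∈ s, v j ∈ W ∧ EvenLine v s p j := by
  classical
  by_contra! hcon
  have hpl : v p ∈ line v p q := left_mem_line
  have hodd : Odd (coflat v (VectorConfig.flat v s W) (line v p q)).card := by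
    have h1 := card_flat_add_card_coflat v (VectorConfig.flat v s W) (line v p q)
    rw [flat_flat_of_le hW] at h1
    have h2 := hpq.2
    rw [← h1] at hWe
    grind
  refine Nat.not_even_iff_odd.2 hodd ?_
  rw [Finset.card_eq_sum_card_image (fun j => line v p j)]
  refine Finset.even_sum _ fun L hL => ?_
  obtain ⟨j, hj, rfl⟩ := Finset.mem_image.1 hL
  simp only [mem_coflat, mem_flat] at hj
  obtain ⟨⟨hj, hjW⟩, hjl⟩ := hj
  have hnot : ∀ k, v k ∉ line v p q → v k ∉ ℝ ∙ v p := fun k hk hki =>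
    hk ((span_singleton_le_iff_mem _ _).2 hpl hki)
  have hoj : OddLine v s p j := (oddLine_or_evenLine s (hnot j hjl)).resolve_right (hcon j hj hjW)
  have h5 := card_flat_add_card_coflat v (VectorConfig.flat v s (line v p j)) (ℝ ∙ v p)
  rw [flat_flat_of_le le_sup_left, h.flat_singleton_eq hp hoj, Finset.card_singleton] at h5
  have hset : ((coflat v (VectorConfig.flat v s W) (line v p q)).filter
      fun k => line v p k = line v p j) =
      coflat v (VectorConfig.flat v s (line v p j)) (ℝ ∙ v p) := by
    ext k
    simp only [Finset.mem_filter, mem_coflat, mem_flat]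
    constructor
    · rintro ⟨⟨⟨hk, -⟩, hkl⟩, he⟩
      exact ⟨⟨hk, he ▸ right_mem_line⟩, hnot k hkl⟩
    · rintro ⟨⟨hk, hkl⟩, hkp⟩
      have he : line v p k = line v p j := sup_span_singleton_eq hkl hkp
      refine ⟨⟨⟨hk, line_le (hW hpl) hjW hkl⟩, fun hkq => hjl ?_⟩, he⟩
      exact (line_le hpl hkq : line v p k ≤ _) (he ▸ right_mem_line)
  rw [hset]
  have h6 := hoj.2
  rw [← h5] at h6
  grind

lemma span_le_of_forall (hU : ∀ i ∈ s, v i ∈ U) : span ℝ (v '' s) ≤ U := by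
  rw [span_le]
  rintro _ ⟨i, hi, rfl⟩
  exact hU i hi

/-- The even lines through a point of an odd line lie in a space of rank three not containing the
odd line. -/
lemma exists_evenLines_le [FiniteDimensional ℝ E]
    (h : Tight v s) (hr : 4 ≤ finrank ℝ (span ℝ (v '' s))) (hp : p ∈ s)
    (hq : q ∈ s) (hpq : OddLine v s p q) :
    ∃ P : Submodule ℝ E, v p ∈ P ∧ finrank ℝ P ≤ 3 ∧ ¬ line v p q ≤ P ∧
      ∀ j ∈ s, EvenLine v s p j → v j ∈ P := by
  obtain ⟨P, hpP, hP, hPe⟩ := h.exists_le_of_odd (h.odd_card_flat_singleton hp hpq)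
  rw [finrank_span_singleton (h.reduced.ne_zero p hp)] at hP
  refine ⟨P, (span_singleton_le_iff_mem _ _).1 hpP, hP, fun hle => ?_,
    fun j hj hje => hPe j hj hje.2⟩
  -- If `P` contained the odd line, then with an even line through `p` in each plane over the odd
  -- line it would contain all those planes, hence everything.
  have : span ℝ (v '' s) ≤ P := span_le_of_forall fun m hm => by
    by_cases hml : v m ∈ line v p q
    · exact hle hml
    obtain ⟨j, hj, hjm, hje⟩ := h.exists_evenLine hp hpq le_sup_left
      (h.even_plane hp hq hm hpq.1 hml)
    have hjl := hje.notMem_line hpq left_mem_line (h.reduced.ne_zero p hp)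
    have h1 := sup_span_singleton_eq hjm hjl
    have h2 : line v p q ⊔ ℝ ∙ v j ≤ P :=
      sup_le hle ((span_singleton_le_iff_mem _ _).2 (hPe j hj hje.2))
    exact h2 (h1 ▸ mem_sup_right (mem_span_singleton_self _))
  have := finrank_mono this
  omega

lemma finrank_line [FiniteDimensional ℝ E]
    (hp : v p ≠ 0) (hpq : v q ∉ ℝ ∙ v p) : finrank ℝ (line v p q) = 2 := by
  rw [line, finrank_sup_span_singleton hpq, finrank_span_singleton hp]

/-- Uniqueness of the even line is where rank 4 enters: two even lines through `a` would span the
plane `W` and put it inside the space `P` of `exists_evenLines_le`, which does not contain the odd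
line. -/
lemma planar [FiniteDimensional ℝ E]
    (h : Tight v s) (hr : 4 ≤ finrank ℝ (span ℝ (v '' s))) (hp : p ∈ s)
    (hq : q ∈ s) (hpq : OddLine v s p q) (hm : m ∈ s) (hmpq : v m ∉ line v p q) :
    Planar v (VectorConfig.flat v s (line v p q ⊔ ℝ ∙ v m)) := by
  have hWe := h.even_plane hp hq hm hpq.1 hmpq
  have hW3 : finrank ℝ ↥(line v p q ⊔ ℝ ∙ v m) = 3 := by
    rw [finrank_sup_span_singleton hmpq, finrank_line (h.reduced.ne_zero p hp) hpq.1]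
  have hmW : v m ∈ line v p q ⊔ ℝ ∙ v m := mem_sup_right (mem_span_singleton_self _)
  have hpqW : line v p q ≤ line v p q ⊔ ℝ ∙ v m := le_sup_left
  set W := line v p q ⊔ ℝ ∙ v m with hW
  have hflat : ∀ i ∈ VectorConfig.flat v s W, ∀ j ∈ VectorConfig.flat v s W,
      VectorConfig.flat v (VectorConfig.flat v s W) (line v i j) =
        VectorConfig.flat v s (line v i j) := fun i hi j hj =>
    flat_flat_of_le (line_le (mem_flat.1 hi).2 (mem_flat.1 hj).2)
  have hodd : ∀ i ∈ VectorConfig.flat v s W, ∀ j ∈ VectorConfig.flat v s W,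
      OddLine v (VectorConfig.flat v s W) i j → OddLine v s i j := fun i hi j hj hij =>
    ⟨hij.1, by rw [← hflat i hi j hj]; exact hij.2⟩
  have heven : ∀ i ∈ VectorConfig.flat v s W, ∀ j ∈ VectorConfig.flat v s W,
      EvenLine v (VectorConfig.flat v s W) i j → EvenLine v s i j := fun i hi j hj hij =>
    ⟨hij.1, by rw [← hflat i hi j hj]; exact hij.2⟩
  have hsup : ∀ a ∈ VectorConfig.flat v s W, ∀ b ∈ VectorConfig.flat v s W,
      OddLine v s a b → ∀ c ∈ VectorConfig.flat v s W, v c ∉ line v a b →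
      line v a b ⊔ ℝ ∙ v c = W := by
    intro a ha b hb hab c hc hcab
    rw [mem_flat] at ha hb hc
    apply eq_of_le_of_finrank_eq
    · exact sup_le (line_le ha.2 hb.2) ((span_singleton_le_iff_mem _ _).2 hc.2)
    · rw [hW3, finrank_sup_span_singleton hcab, finrank_line (h.reduced.ne_zero a ha.1) hab.1]
  refine ⟨h.flat hWe, ?_, ?_, ?_⟩
  · intro a ha b hb hab c hc hcab i hi
    rw [hsup a ha b hb (hodd a ha b hb hab) c hc hcab]
    exact (mem_flat.1 hi).2
  · intro a ha b hb hab
    have hab' := hodd a ha b hb hab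
    have ha' := mem_flat.1 ha
    have hb' := mem_flat.1 hb
    obtain ⟨j, hj, hjW, hje⟩ := h.exists_evenLine ha'.1 hab' (line_le ha'.2 hb'.2) hWe
    have hjt : j ∈ VectorConfig.flat v s W := mem_flat.2 ⟨hj, hjW⟩
    exact ⟨j, hjt, hje.1, by rw [hflat a ha j hjt]; exact hje.2⟩
  · intro a ha b hb hab j hj j' hj' haj haj'
    have hab' := hodd a ha b hb hab
    have ha' := mem_flat.1 ha
    have hb' := mem_flat.1 hb
    have ha0 := h.reduced.ne_zero a ha'.1
    obtain ⟨P, haP, -, hPle, hPe⟩ := h.exists_evenLines_le hr ha'.1 hb'.1 hab'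
    by_contra hne
    have hj'l : v j' ∉ line v a j := fun hmem => hne (sup_span_singleton_eq hmem haj'.1).symm
    have hjP := hPe j (mem_flat.1 hj).1 (heven a ha j hj haj)
    have hj'P := hPe j' (mem_flat.1 hj').1 (heven a ha j' hj' haj')
    have h1 : line v a j ⊔ ℝ ∙ v j' = W := by
      apply eq_of_le_of_finrank_eq
      · exact sup_le (line_le ha'.2 (mem_flat.1 hj).2)
          ((span_singleton_le_iff_mem _ _).2 (mem_flat.1 hj').2)
      · rw [hW3, finrank_sup_span_singleton hj'l, finrank_line ha0 haj.1]
    have h2 : W ≤ P := h1 ▸ sup_le (line_le haP hjP) ((span_singleton_le_iff_mem _ _).2 hj'P)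
    exact hPle ((line_le ha'.2 hb'.2).trans h2)

/-- If all multiplicities were even, repeated directions would give third points on every line and
the rank would be at most 2. A point of odd multiplicity has all its even lines in rank 3, so a
vector outside is joined to it by an odd line. -/
lemma exists_oddLine [FiniteDimensional ℝ E]
    (h : Tight v s) (hr : 4 ≤ finrank ℝ (span ℝ (v '' s))) :
    ∃ p ∈ s, ∃ q ∈ s, OddLine v s p q := by
  have hsingle : ∃ p ∈ s, Odd (VectorConfig.flat v s (ℝ ∙ v p)).card := by
    by_contra! hcon
    have h2 : ∀ p ∈ s, 2 ≤ (VectorConfig.flat v s (ℝ ∙ v p)).card := fun p hp => by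
      have h1 := hcon p hp
      rw [Nat.not_odd_iff_even] at h1
      have : 0 < (VectorConfig.flat v s (ℝ ∙ v p)).card :=
        Finset.card_pos.2 ⟨p, mem_flat.2 ⟨hp, mem_span_singleton_self _⟩⟩
      rcases h1 with ⟨n, hn⟩; omega
    have := finrank_span_image_le_two h.reduced.ne_zero fun i hi j hj k hk hij => by
      rw [span_pair_eq_line]
      exact mem_line_of_no_ordinary_line h.reduced.ne_zero
        (fun a ha b hb hab => h.exists_third_of_two_le ha hb hab (h2 a ha)) hi hj hk hij
    omega
  obtain ⟨p, hp, hodd⟩ := hsingle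
  obtain ⟨P, hpP, hP, hPe⟩ := h.exists_le_of_odd hodd
  rw [finrank_span_singleton (h.reduced.ne_zero p hp)] at hP
  have : ∃ q ∈ s, v q ∉ P := by
    by_contra! hcon
    have := finrank_mono (span_le_of_forall hcon)
    omega
  obtain ⟨q, hq, hqP⟩ := this
  exact ⟨p, hp, q, hq, (oddLine_or_evenLine s fun h1 => hqP (hpP h1)).resolve_right
    fun he => hqP (hPe q hq he.2)⟩

/-- A reduced configuration of discrepancy two and rank at least four consists of two skew
planar configurations of odd size. -/
theorem exists_skew [FiniteDimensional ℝ E] (h : Tight v s) (hr : 4 ≤ finrank ℝ (span ℝ (v '' s))) :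
    ∃ U W : Submodule ℝ E, Disjoint U W ∧ finrank ℝ U ≤ 2 ∧ finrank ℝ W ≤ 2 ∧
      (∀ i ∈ s, v i ∈ U ∨ v i ∈ W) ∧ Odd (VectorConfig.flat v s U).card ∧
      Odd (VectorConfig.flat v s W).card := by
  obtain ⟨p, hp, q, hq, hpq⟩ := h.exists_oddLine hr
  have hp0 := h.reduced.ne_zero p hp
  have hqp := hpq.symm hp0
  -- The plane through the odd line and `j` has an even line through `a`; it leaves the odd line,
  -- and `j` is the only point there.
  have heven : ∀ a ∈ s, ∀ b ∈ s, OddLine v s a b → ∀ j ∈ s, v j ∉ line v a b →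
      EvenLine v s a j := by
    intro a ha b hb hab j hj hjab
    obtain ⟨k, hk, hkW, hke⟩ := h.exists_evenLine ha hab le_sup_left
      (h.even_plane ha hb hj hab.1 hjab)
    have hk' := hke.notMem_line hab left_mem_line (h.reduced.ne_zero a ha)
    have hjk : j = k := (h.planar hr ha hb hab hj hjab).eq_of_notMem_line
      (mem_flat.2 ⟨ha, mem_sup_left left_mem_line⟩) (mem_flat.2 ⟨hb, mem_sup_left right_mem_line⟩)
      ⟨hab.1, by rw [flat_flat_of_le le_sup_left]; exact hab.2⟩
      (mem_flat.2 ⟨hj, mem_sup_right (mem_span_singleton_self _)⟩) (mem_flat.2 ⟨hk, hkW⟩) hjab hk'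
    rwa [hjk]
  obtain ⟨P, hpP, hP3, hPle, hPe⟩ := h.exists_evenLines_le hr hp hq hpq
  obtain ⟨Q, hqQ, hQ3, hQle, hQe⟩ := h.exists_evenLines_le hr hq hp hqp
  set W := span ℝ (v '' coflat v s (line v p q)) with hW
  have hWP : W ≤ P := span_le_of_forall fun j hj =>
    hPe j (mem_coflat.1 hj).1 (heven p hp q hq hpq j (mem_coflat.1 hj).1 (mem_coflat.1 hj).2)
  have hWQ : W ≤ Q := span_le_of_forall fun j hj =>
    hQe j (mem_coflat.1 hj).1 (heven q hq p hp hqp j (mem_coflat.1 hj).1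
      (by rw [line_comm]; exact (mem_coflat.1 hj).2))
  -- In rank 3, `W` would equal both `P` and `Q` and so contain `p` and `q`, though `P` does not
  -- contain the odd line.
  have hW2 : finrank ℝ W ≤ 2 := by
    by_contra! hW3
    have e1 : W = P := eq_of_le_of_finrank_le hWP (by omega)
    have e2 : W = Q := eq_of_le_of_finrank_le hWQ (by omega)
    exact hPle (line_le hpP (by rw [← e1, e2]; exact hqQ))
  have hU2 : finrank ℝ (line v p q) = 2 := finrank_line hp0 hpq.1
  have hcov : ∀ i ∈ s, v i ∈ line v p q ∨ v i ∈ W := fun i hi => by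
    by_cases hil : v i ∈ line v p q
    · exact Or.inl hil
    · exact Or.inr (subset_span ⟨i, mem_coflat.2 ⟨hi, hil⟩, rfl⟩)
  have hsup : 4 ≤ finrank ℝ ↥(line v p q ⊔ W) := hr.trans <| finrank_mono <|
    span_le_of_forall fun i hi => (hcov i hi).elim mem_sup_left mem_sup_right
  have hdis : Disjoint (line v p q) W := by
    have := finrank_sup_add_finrank_inf_eq (line v p q) W
    rw [disjoint_iff, ← finrank_eq_zero (R := ℝ)]
    omega
  refine ⟨line v p q, W, hdis, hU2.le, hW2, hcov, hpq.2, ?_⟩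
  have : VectorConfig.flat v s W = coflat v s (line v p q) := by
    ext i
    simp only [mem_flat, mem_coflat, and_congr_right_iff]
    intro hi
    refine ⟨fun hiW hil => h.reduced.ne_zero i hi (disjoint_def.1 hdis _ hil hiW),
      fun hil => (hcov i hi).resolve_left hil⟩
  rw [this]
  exact h.odd_coflat hpq.2

end Tight

end VectorConfig

/-! ### Codegree counts and decompositions. -/

namespace VectorConfig

open Module Submodule

section Fintype

variable {κ E : Type*} [Fintype κ] [AddCommGroup E] [Module ℝ E] {u : κ → E} {f g : Dual ℝ E}

lemma natAbs_signSum (u : κ → E) (f : Dual ℝ E) :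
    (signSum u Finset.univ f).natAbs = signDisc fun i => SignType.sign (f (u i)) := by
  unfold signDisc signSum
  congr 1
  rw [Finset.card_filter, Finset.card_filter]
  push_cast
  rw [← Finset.sum_sub_distrib]
  refine Finset.sum_congr rfl fun i _ => ?_
  cases SignType.sign (f (u i)) <;> rfl

lemma disc_le_iff {k : ℕ} : disc u ≤ k ↔ SignBound u Finset.univ k := by
  constructor
  · intro h f
    have h1 := (isGreatest_disc u).2 ⟨_, ⟨f, rfl⟩, rfl⟩
    rw [← natAbs_signSum] at h1
    rw [Int.abs_eq_natAbs]
    omega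
  · intro h
    obtain ⟨_, ⟨f, rfl⟩, hf⟩ := (isGreatest_disc u).1
    have h1 := h f
    rw [← natAbs_signSum] at hf
    rw [Int.abs_eq_natAbs] at h1
    omega

lemma posCount_add_nonposCount (u : κ → E) (f : Dual ℝ E) :
    posCount u f + nonposCount u f = Fintype.card κ := by
  classical
  unfold posCount nonposCount
  rw [← Finset.card_univ, ← Finset.card_filter_add_card_filter_not (s := Finset.univ)
    fun i => 0 < f (u i)]
  simp only [not_lt]

lemma signSum_eq_two_mul_posCount_sub (h : ∀ i, f (u i) ≠ 0) :
    signSum u Finset.univ f = 2 * posCount u f - Fintype.card κ := by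
  classical
  unfold signSum posCount
  rw [Finset.card_filter, ← Finset.card_univ, Finset.card_eq_sum_ones]
  push_cast
  rw [Finset.mul_sum, ← Finset.sum_sub_distrib]
  refine Finset.sum_congr rfl fun i _ => ?_
  rcases lt_or_gt_of_ne (h i) with h1 | h1
  · simp [sign_neg h1, h1.not_gt]
  · simp [sign_pos h1, h1]

/-- Both maxima are attained by functionals vanishing on no vector, and for those the signed count
is twice the positive count minus the size. -/
lemma two_mul_sSup_posCount (h0 : ∀ i, u i ≠ 0) :
    2 * sSup (Set.range (posCount u)) = Fintype.card κ + disc u := by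
  classical
  have hb : SignBound u Finset.univ (disc u) := disc_le_iff.1 le_rfl
  obtain ⟨⟨f, hf⟩, hmax⟩ := isGreatest_posCount u
  apply le_antisymm
  · obtain ⟨g₀, -, hg₀⟩ := exists_generic u Finset.univ (⊥ : Submodule ℝ E)
    obtain ⟨ε, -, h1, h2, -⟩ := signSum_perturb u Finset.univ f g₀
    set g := f + ε • g₀
    have hg : ∀ i, g (u i) ≠ 0 := fun i => by
      rw [← sign_ne_zero]
      by_cases hfi : f (u i) = 0
      · rw [h2 i (Finset.mem_univ _) hfi]
        exact sign_ne_zero.2 (hg₀ i (Finset.mem_univ _) (by simpa using h0 i))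
      · rw [h1 i (Finset.mem_univ _) hfi]
        exact sign_ne_zero.2 hfi
    have hle : posCount u f ≤ posCount u g := by
      refine Finset.card_le_card fun i hi => ?_
      simp only [Finset.mem_filter, Finset.mem_univ, true_and] at hi ⊢
      rw [← sign_eq_one_iff, h1 i (Finset.mem_univ _) hi.ne', sign_pos hi]
    have h3 := hb g
    rw [signSum_eq_two_mul_posCount_sub hg] at h3
    rw [← hf]
    grind
  · obtain ⟨_, ⟨f, rfl⟩, hf⟩ := (isGreatest_disc u).1
    rw [← natAbs_signSum] at hf
    obtain ⟨g, hg, hfg⟩ := exists_generic_ge (s := Finset.univ) (fun i _ => h0 i) f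
    have hg : ∀ i, g (u i) ≠ 0 := fun i => hg i (Finset.mem_univ _)
    have key : ∀ g : Dual ℝ E, (∀ i, g (u i) ≠ 0) → (disc u : ℤ) ≤ signSum u Finset.univ g →
        Fintype.card κ + disc u ≤ 2 * sSup (Set.range (posCount u)) := by
      intro g hg h1
      rw [signSum_eq_two_mul_posCount_sub hg] at h1
      have := hmax ⟨g, rfl⟩
      omega
    rw [Int.abs_eq_natAbs (signSum u Finset.univ f)] at hfg
    rcases le_total 0 (signSum u Finset.univ g) with h1 | h1
    · exact key g hg (by rw [abs_of_nonneg h1] at hfg; omega)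
    · exact key (-g) (fun i => by simpa using hg i) (by
        rw [signSum_neg]; rw [abs_of_nonpos h1] at hfg; omega)

lemma codegStar_add_sSup_posCount (u : κ → E) :
    codegStar u + sSup (Set.range (posCount u)) = Fintype.card κ := by
  obtain ⟨⟨f, hf⟩, hmax⟩ := isGreatest_posCount u
  obtain ⟨⟨g, hg⟩, hmin⟩ := isLeast_codegStar u
  have h1 := posCount_add_nonposCount u f
  have h2 := posCount_add_nonposCount u g
  have h3 := hmax ⟨g, rfl⟩
  have h4 := hmin ⟨f, rfl⟩
  omega

lemma two_mul_codegStar_add_disc (h0 : ∀ i, u i ≠ 0) :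
    2 * codegStar u + disc u = Fintype.card κ := by
  have h1 := two_mul_sSup_posCount h0
  have h2 := codegStar_add_sSup_posCount u
  omega

end Fintype

variable {ι E : Type*} [AddCommGroup E] [Module ℝ E] {v : ι → E} {s t : Finset ι}

lemma signSum_sub (v : ι → E) (s : Finset ι) (f : Dual ℝ E) :
    signSum (sub v s) Finset.univ f = signSum v s f :=
  Finset.sum_coe_sort s fun i => (SignType.sign (f (v i)) : ℤ)

lemma disc_sub_le_iff {k : ℕ} : disc (sub v s) ≤ k ↔ SignBound v s k := by
  rw [disc_le_iff]
  simp only [SignBound, signSum_sub]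

lemma two_mul_codegStar_sub (h0 : ∀ i, v i ≠ 0) (s : Finset ι) :
    2 * codegStar (sub v s) + disc (sub v s) = s.card := by
  rw [two_mul_codegStar_add_disc (u := sub v s) fun i => h0 i, Fintype.card_coe]

lemma two_mul_codegStar_sub_of_odd (h0 : ∀ i, v i ≠ 0) (hs : Odd s.card)
    (hB : SignBound v s 1) : 2 * codegStar (sub v s) + 1 = s.card := by
  have h1 := two_mul_codegStar_sub h0 s
  have h2 : disc (sub v s) ≤ 1 := disc_sub_le_iff.2 (by simpa using hB)
  obtain ⟨m, hm⟩ := hs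
  omega

omit [AddCommGroup E] [Module ℝ E] in
lemma range_sub (v : ι → E) (s : Finset ι) : Set.range (sub v s) = v '' s := by
  ext x
  simp [sub]

lemma rank_sub (v : ι → E) (s : Finset ι) : rank (sub v s) = finrank ℝ (span ℝ (v '' s)) := by
  rw [rank, range_sub]

lemma rank_sub_le_card (v : ι → E) (s : Finset ι) : rank (sub v s) ≤ s.card := by
  classical
  rw [rank_sub, ← Finset.coe_image]
  exact (finrank_span_finset_le_card (R := ℝ) (s.image v)).trans Finset.card_image_le

section Parts

variable [DecidableEq ι]

lemma rank_sub_union_le (v : ι → E) (s t : Finset ι) :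
    rank (sub v (s ∪ t)) ≤ rank (sub v s) + rank (sub v t) := by
  have := FiniteDimensional.span_of_finite ℝ (s.finite_toSet.image v)
  have := FiniteDimensional.span_of_finite ℝ (t.finite_toSet.image v)
  rw [rank_sub, rank_sub, rank_sub, Finset.coe_union, Set.image_union, span_union]
  exact finrank_add_le_finrank_add_finrank _ _

/-- Disjoint subsets of `s` of positive dual codegree adding up to `c`. -/
def HasParts (v : ι → E) (s : Finset ι) (m c : ℕ) : Prop :=
  ∃ Q : Fin m → Finset ι, (∀ i j, i ≠ j → Disjoint (Q i) (Q j)) ∧ (∀ i, Q i ⊆ s) ∧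
    ∑ i, codegStar (sub v (Q i)) = c ∧ ∀ i, 1 ≤ codegStar (sub v (Q i))

lemma HasParts.cons {m c : ℕ} (h : HasParts v s m c) (hts : Disjoint t s)
    (ht : 1 ≤ codegStar (sub v t)) :
    HasParts v (t ∪ s) (m + 1) (codegStar (sub v t) + c) := by
  obtain ⟨Q, hd, hs, hc, h1⟩ := h
  refine ⟨Fin.cons t Q, ?_, ?_, ?_, ?_⟩
  · intro i j hij
    induction i using Fin.cases with
    | zero =>
      induction j using Fin.cases with
      | zero => exact absurd rfl hij
      | succ j => simpa using hts.mono_right (hs j)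
    | succ i =>
      induction j using Fin.cases with
      | zero => simpa using (hts.mono_right (hs i)).symm
      | succ j => simpa using hd i j fun h => hij (by rw [h])
  · intro i
    induction i using Fin.cases with
    | zero => simp
    | succ i => simpa using (hs i).trans Finset.subset_union_right
  · rw [Fin.sum_univ_succ]
    change codegStar (sub v t) + ∑ i, codegStar (sub v (Q i)) = _
    rw [hc]
  · intro i
    induction i using Fin.cases with
    | zero => exact ht
    | succ i => exact h1 i

lemma HasParts.hasCodegStarDecomposition [Fintype ι] {m : ℕ}
    (h : HasParts v s m (codegStar v)) : HasCodegStarDecomposition v m := by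
  obtain ⟨Q, hd, -, hc, h1⟩ := h
  refine ⟨Fin.cons (Finset.univ.biUnion Q)ᶜ Q, ?_, ?_, ?_, ?_⟩
  · have h2 : ∀ i, Disjoint (Finset.univ.biUnion Q)ᶜ (Q i) := fun i =>
      disjoint_compl_left.mono_right (Finset.subset_biUnion_of_mem Q (Finset.mem_univ i))
    intro i j hij
    induction i using Fin.cases with
    | zero =>
      induction j using Fin.cases with
      | zero => exact absurd rfl hij
      | succ j => simpa using h2 j
    | succ i =>
      induction j using Fin.cases with
      | zero => simpa using (h2 i).symm
      | succ j => simpa using hd i j fun h => hij (by rw [h])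
  · intro a
    by_cases ha : a ∈ Finset.univ.biUnion Q
    · obtain ⟨i, -, hi⟩ := Finset.mem_biUnion.1 ha
      exact ⟨i.succ, by simpa using hi⟩
    · exact ⟨0, by simpa using ha⟩
  · exact hc.symm
  · exact h1

/-- Each pair has discrepancy 0 and two elements, so it is a part of codegree 1, and it spans a
line. -/
lemma AntipodalPairs.exists_hasParts (h : AntipodalPairs v s) (h0 : ∀ i, v i ≠ 0) :
    ∃ k, s.card = 2 * k ∧ HasParts v s k k ∧ rank (sub v s) ≤ k := by
  induction h with
  | empty => exact ⟨0, rfl, ⟨Fin.elim0, by simp, by simp, by simp, by simp⟩, by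
      simpa using rank_sub_le_card v ∅⟩
  | cons i j s hi hj hij c hc h hs ih =>
    obtain ⟨k, hk, hparts, hrank⟩ := ih
    have hcard : ({i, j} : Finset ι).card = 2 := Finset.card_pair hij
    have heq : insert i (insert j s) = {i, j} ∪ s := by
      ext; simp
    have hdis : Disjoint ({i, j} : Finset ι) s := by
      simp [Finset.disjoint_left, hi, hj]
    have hpair : AntipodalPairs v {i, j} := by
      have := AntipodalPairs.cons i j ∅ (by simp) (by simp) hij c hc h .empty
      simpa using this
    have hcodeg : codegStar (sub v ({i, j} : Finset ι)) = 1 := by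
      have h1 := two_mul_codegStar_sub h0 {i, j}
      have h2 : disc (sub v ({i, j} : Finset ι)) ≤ 0 :=
        disc_sub_le_iff.2 fun f => by simp [hpair.signSum_eq_zero f]
      omega
    have hr : rank (sub v ({i, j} : Finset ι)) ≤ 1 := by
      have hle : span ℝ (v '' ({i, j} : Finset ι)) ≤ ℝ ∙ v i := by
        rw [span_le]
        rintro _ ⟨l, hl, rfl⟩
        simp only [Finset.coe_insert, Finset.coe_singleton, Set.mem_insert_iff,
          Set.mem_singleton_iff] at hl
        rcases hl with rfl | rfl
        · exact mem_span_singleton_self _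
        · rw [h]
          exact neg_mem (smul_mem _ _ (mem_span_singleton_self _))
      rw [rank_sub]
      exact (finrank_mono hle).trans (finrank_span_singleton (h0 i)).le
    refine ⟨k + 1, ?_, ?_, ?_⟩
    · rw [heq, Finset.card_union_of_disjoint hdis]; omega
    · have := hparts.cons hdis hcodeg.ge
      rw [hcodeg, add_comm 1 k] at this
      rwa [heq]
    · rw [heq]
      have := rank_sub_union_le v {i, j} s
      omega

lemma AntipodalPairs.isCentrallySymmetric (h : AntipodalPairs v s) :
    IsCentrallySymmetric (sub v s) := by
  have key : ∃ σ : ι → ι, ∀ i ∈ s, σ i ∈ s ∧ σ (σ i) = i ∧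
      ∃ c : ℝ, 0 < c ∧ v (σ i) = -(c • v i) := by
    induction h with
    | empty => exact ⟨id, by simp⟩
    | cons i j s hi hj hij c hc h hs ih =>
      obtain ⟨σ, hσ⟩ := ih
      refine ⟨fun k => if k = i then j else if k = j then i else σ k, fun k hk => ?_⟩
      by_cases hki : k = i
      · subst hki
        simp [hij.symm]
        exact ⟨c, hc, h⟩
      by_cases hkj : k = j
      · subst hkj
        simp [hij.symm]
        refine ⟨c⁻¹, by positivity, ?_⟩
        rw [h, smul_neg, neg_neg, smul_smul, inv_mul_cancel₀ hc.ne', one_smul]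
      · have hks : k ∈ s := by simpa [hki, hkj] using hk
        obtain ⟨h1, h2, h3⟩ := hσ k hks
        have h4 : σ k ≠ i := fun h => hi (h ▸ h1)
        have h5 : σ k ≠ j := fun h => hj (h ▸ h1)
        simp only [hki, hkj, h4, h5, if_false, h2, true_and]
        exact ⟨by simp [h1], h3⟩
  obtain ⟨σ, hσ⟩ := key
  refine ⟨fun i => ⟨σ i, (hσ i i.2).1⟩, fun i => Subtype.ext (hσ i i.2).2.1, fun i => ?_⟩
  exact (hσ i i.2).2.2

end Parts

/-- A reduced configuration of discrepancy at most two has small rank or consists of two skew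
planar configurations of odd size. -/
lemma Reduced.finrank_le_or_exists_skew [FiniteDimensional ℝ E] (h : Reduced v s) {k : ℕ}
    (hB : SignBound v s k) (hk : k ≤ 2) :
    finrank ℝ (span ℝ (v '' s)) ≤ k + 1 ∨ k = 2 ∧
      ∃ U W : Submodule ℝ E, Disjoint U W ∧ finrank ℝ U ≤ 2 ∧ finrank ℝ W ≤ 2 ∧
      (∀ i ∈ s, v i ∈ U ∨ v i ∈ W) ∧ Odd (flat v s U).card ∧ Odd (flat v s W).card ∧
      SignBound v (flat v s U) 1 ∧ SignBound v (flat v s W) 1 := by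
  interval_cases k
  · left
    rcases s.eq_empty_or_nonempty with rfl | hs
    · rw [Finset.coe_empty, Set.image_empty, span_empty, finrank_bot]
      exact Nat.zero_le _
    · obtain ⟨g, -, hg⟩ := h.exists_signSum_ne_zero hs
      exact absurd (by simpa using hB g) hg
  · exact Or.inl (h.finrank_le_two (by simpa using hB))
  · have hB : SignBound v s 2 := by simpa using hB
    rcases Nat.even_or_odd s.card with he | ho
    · have hT : Tight v s := ⟨h, hB, he⟩
      by_cases hr : finrank ℝ (span ℝ (v '' s)) ≤ 3
      · exact Or.inl hr
      · obtain ⟨U, W, h1, h2, h3, h4, h5, h6⟩ := hT.exists_skew (by omega)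
        exact Or.inr ⟨rfl, U, W, h1, h2, h3, h4, h5, h6, hT.signBound_one h5,
          hT.signBound_one h6⟩
    -- For odd size generic counts are odd, so the bound 2 improves to 1.
    · refine Or.inl ((h.finrank_le_two fun f => ?_).trans (by norm_num))
      obtain ⟨g, hg, hfg⟩ := exists_generic_ge h.ne_zero f
      have h1 := hB g
      have h2 := signSum_emod_two hg
      obtain ⟨m, hm⟩ := ho
      rw [hm] at h2
      grind

/-- The corestriction of a configuration to its linear span. -/
def toSpan (v : ι → E) (i : ι) : span ℝ (Set.range v) := ⟨v i, subset_span ⟨i, rfl⟩⟩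

lemma signSum_toSpan (s : Finset ι) (f : Dual ℝ E) :
    signSum (toSpan v) s (f.comp (span ℝ (Set.range v)).subtype) = signSum v s f := rfl

lemma signBound_toSpan_iff {k : ℤ} : SignBound (toSpan v) s k ↔ SignBound v s k := by
  constructor
  · intro h f
    rw [← signSum_toSpan]
    exact h _
  · intro h f
    obtain ⟨g, rfl⟩ := LinearMap.exists_extend f
    exact h g

lemma Reduced.toSpan (h : Reduced v s) : Reduced (toSpan v) s :=
  ⟨fun i hi h0 => h.ne_zero i hi (congrArg Subtype.val h0),
    fun i hi j hj c hc h0 => h.not_antipodal i hi j hj c hc (congrArg Subtype.val h0)⟩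

lemma map_span_toSpan (s : Finset ι) : (span ℝ (toSpan v '' s)).map
    (span ℝ (Set.range v)).subtype = span ℝ (v '' s) := by
  rw [map_span, ← Set.image_comp]
  rfl

lemma finrank_span_toSpan (s : Finset ι) :
    finrank ℝ (span ℝ (toSpan v '' s)) = rank (sub v s) := by
  rw [rank_sub, ← map_span_toSpan (v := v), finrank_map_subtype_eq]

lemma isSkew_sub_of_toSpan {U W : Submodule ℝ (span ℝ (Set.range v))} (h : Disjoint U W) :
    IsSkew (sub v (flat (toSpan v) s U)) (sub v (flat (toSpan v) s W)) := by
  have hle : ∀ U, span ℝ (toSpan v '' flat (toSpan v) s U) ≤ U := fun U => by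
    rw [span_le]
    rintro _ ⟨i, hi, rfl⟩
    exact (mem_flat.1 hi).2
  rw [IsSkew, range_sub, range_sub, ← map_span_toSpan (v := v), ← map_span_toSpan (v := v)]
  exact Submodule.disjoint_map (subtype_injective _) (h.mono (hle U) (hle W))

lemma rank_sub_flat_toSpan_le [Finite ι] (U : Submodule ℝ (span ℝ (Set.range v))) :
    rank (sub v (flat (toSpan v) s U)) ≤ finrank ℝ U := by
  have := FiniteDimensional.span_of_finite ℝ (Set.finite_range v)
  rw [← finrank_span_toSpan]
  apply finrank_mono
  rw [span_le]
  rintro _ ⟨i, hi, rfl⟩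
  exact (mem_flat.1 hi).2

end VectorConfig

/-! ### Assembling the theorem. -/

theorem mainTheorem1 {ι E : Type*} [Fintype ι] [DecidableEq ι] [AddCommGroup E] [Module ℝ E]
    (v : ι → E) (hirr : VectorConfig.IsIrreducible v) (hdisc : VectorConfig.disc v ≤ 2)
    (r : ℕ) (hr : VectorConfig.rank v = r)
    (d : ℤ) (hd : (Fintype.card ι : ℤ) = (r : ℤ) + d + 1) :
    (∃ m : ℕ, (r : ℤ) - (VectorConfig.disc v : ℤ) ≤ (m : ℤ) ∧
      VectorConfig.HasCodegStarDecomposition v m) ∧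
    (r : ℤ) - (VectorConfig.disc v : ℤ) = d + 1 - 2 * VectorConfig.degStar v ∧
    ((∃ W : Finset ι,
        VectorConfig.IsCentrallySymmetric (VectorConfig.sub v Wᶜ) ∧
        VectorConfig.rank (VectorConfig.sub v W) ≤ 3) ∨
      (∃ W₁ W₂ : Finset ι,
        VectorConfig.IsCentrallySymmetric (VectorConfig.sub v (W₁ ∪ W₂)ᶜ) ∧
        VectorConfig.rank (VectorConfig.sub v W₁) ≤ 2 ∧
        VectorConfig.rank (VectorConfig.sub v W₂) ≤ 2 ∧
        VectorConfig.IsSkew (VectorConfig.sub v W₁) (VectorConfig.sub v W₂))) := by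
  open VectorConfig in
  have := FiniteDimensional.span_of_finite ℝ (Set.finite_range v)
  obtain ⟨T, -, hT, hp⟩ := exists_reduced v Finset.univ fun i _ => hirr i
  have hsum : ∀ f, signSum v T f = signSum v Finset.univ f := fun f => by
    rw [← signSum_sdiff_add (Finset.subset_univ T), hp.signSum_eq_zero, zero_add]
  have hBT : ∀ k : ℕ, SignBound v T k ↔ SignBound v Finset.univ k := fun k => by
    simp only [SignBound, hsum]
  have hBD : SignBound v T (disc v) := (hBT _).2 (disc_le_iff.1 le_rfl)
  have hdiscT : disc (sub v T) = disc v := le_antisymm (disc_sub_le_iff.2 hBD)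
    (disc_le_iff.2 ((hBT _).1 (disc_sub_le_iff.1 le_rfl)))
  rw [← Finset.compl_eq_univ_sdiff] at hp
  obtain ⟨k, hk, hparts, hrk⟩ := hp.exists_hasParts hirr
  have hcard : Fintype.card ι = 2 * k + T.card := by
    rw [← hk, Finset.card_compl_add_card]
  have hcodeg := two_mul_codegStar_add_disc hirr
  have hcodegT := two_mul_codegStar_sub hirr T
  rw [hdiscT] at hcodegT
  have hrank : r ≤ k + rank (sub v T) := by
    have h1 := rank_sub_union_le v Tᶜ T
    rw [Finset.union_comm, Finset.union_compl, rank_sub, Finset.coe_univ, Set.image_univ] at h1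
    rw [← hr]
    exact h1.trans (by omega)
  have hcs := hp.isCentrallySymmetric
  have hdeg : (r : ℤ) - (disc v : ℤ) = d + 1 - 2 * degStar v := by
    have h1 := two_mul_sSup_posCount hirr
    rw [degStar, hr]
    omega
  -- `E` may be infinite-dimensional, so the structure theorem is applied inside the span of `v`.
  have key := hT.toSpan.finrank_le_or_exists_skew (signBound_toSpan_iff.2 hBD) hdisc
  rw [finrank_span_toSpan] at key
  have hsmall : rank (sub v T) ≤ disc v + 1 →
      ∃ m : ℕ, (r : ℤ) - (disc v : ℤ) ≤ (m : ℤ) ∧ HasCodegStarDecomposition v m := by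
    intro hle
    -- If `T` has codegree 0, then `T.card = disc v` bounds its rank and the `k` pairs suffice;
    -- otherwise `T` is one more part.
    rcases Nat.eq_zero_or_pos (codegStar (sub v T)) with h0 | h1
    · have h2 := rank_sub_le_card v T
      refine ⟨k, by omega, HasParts.hasCodegStarDecomposition (s := Tᶜ) ?_⟩
      convert hparts using 1
      omega
    · refine ⟨k + 1, by omega, HasParts.hasCodegStarDecomposition (s := T ∪ Tᶜ) ?_⟩
      convert hparts.cons disjoint_compl_right h1 using 1
      omega
  by_cases h3 : rank (sub v T) ≤ disc v + 1
  · exact ⟨hsmall h3, hdeg, Or.inl ⟨T, hcs, by omega⟩⟩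
  · obtain ⟨hd2, U, W, hUW, hU, hW, hcov, hUo, hWo, hUB, hWB⟩ := key.resolve_left h3
    have hskew := isSkew_sub_of_toSpan (s := T) hUW
    have hU' := (rank_sub_flat_toSpan_le (s := T) U).trans hU
    have hW' := (rank_sub_flat_toSpan_le (s := T) W).trans hW
    rw [signBound_toSpan_iff] at hUB hWB
    have hunion : flat (toSpan v) T U ∪ flat (toSpan v) T W = T := by
      ext i
      simp only [Finset.mem_union, mem_flat]
      exact ⟨fun h => h.elim And.left And.left, fun h => (hcov i h).imp (⟨h, ·⟩) (⟨h, ·⟩)⟩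
    have hdis : Disjoint (flat (toSpan v) T U) (flat (toSpan v) T W) := by
      rw [Finset.disjoint_left]
      intro i h1 h2
      rw [mem_flat] at h1 h2
      exact hT.toSpan.ne_zero i h1.1 (Submodule.disjoint_def.1 hUW _ h1.2 h2.2)
    generalize flat (toSpan v) T U = W₁ at *
    generalize flat (toSpan v) T W = W₂ at *
    subst hunion
    -- Together the two pieces have rank at least 4, so each has rank 2, odd size at least 3 and
    -- positive codegree. Each loses 1 to its discrepancy, and these losses add up to `disc v = 2`.
    have c1 := two_mul_codegStar_sub_of_odd hirr hUo hUB
    have c2 := two_mul_codegStar_sub_of_odd hirr hWo hWB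
    have r1 := rank_sub_le_card v W₁
    have r2 := rank_sub_le_card v W₂
    have r3 := rank_sub_union_le v W₁ W₂
    have c3 := Finset.card_union_of_disjoint hdis
    refine ⟨⟨k + 1 + 1, by omega, HasParts.hasCodegStarDecomposition
      (s := W₁ ∪ (W₂ ∪ (W₁ ∪ W₂)ᶜ)) ?_⟩, hdeg, Or.inr ⟨W₁, W₂, hcs, hU', hW', hskew⟩⟩
    have d2 : Disjoint W₂ (W₁ ∪ W₂)ᶜ := disjoint_compl_right.mono_left Finset.subset_union_right
    have d1 : Disjoint W₁ (W₂ ∪ (W₁ ∪ W₂)ᶜ) := Finset.disjoint_union_right.2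
      ⟨hdis, disjoint_compl_right.mono_left Finset.subset_union_left⟩
    convert (hparts.cons d2 (by omega)).cons d1 (by omega) using 1
    omega
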